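/- Let $G$ be a finite-dimensional real Lie group with identity $e$, Lie algebra $\mathfrak g$ and dual $\mathfrak g^*$, and let $\tau$ be a smooth diffeomorphism (for instance an analytic one) from an open neighbourhood $\mathcal U=-\mathcal U$ of $0\in\mathfrak g$ onto an open neighbourhood of $e\in G$, with $\tau(0)=e$ and $\tau(\xi)\tau(-\xi)=e$. Let $d\tau_\xi\delta = TR_{\tau(\xi)^{-1}}(D\tau(\xi)\delta)$ be its right-trivialized tangent, $d\tau_\xi^{-1}\delta=D\tau^{-1}(\tau(\xi))(TR_{\tau(\xi)}\delta)$ the inverse one, and let ${}^*$ denote dual maps on $\mathfrak g^*$. Let $\ell:G\times\mathfrak g\to\mathbb R$ be smooth and let $g\frac{\partial\ell}{\partial g}\in\mathfrak g^*$ be given by $\langle g\frac{\partial\ell}{\partial g},\eta\rangle=\langle\frac{\partial\ell}{\partial g},TL_g\eta\rangle$. Let $a_{ij},b_i\in\mathbb R$ $(i,j=1,\dots,s)$ with all $b_i\ne0$, let $h>0$, and let $N\ge1$. For $g_1,g_2\in G$ let $\mathcal C_d(g_1,g_2)$ be the set of discrete curves $c_d=(g_k,\mu_k,\{\Theta_k^i,\Xi_k^i,\mu_k^i\}_{i=1}^s)_{k=0}^N$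 in $(G\times\mathfrak g^*)\times(\mathfrak g\times\mathfrak g\times\mathfrak g^*)^s$ with $g_0=g_1$ and $g_N=g_2$ as prescribed endpoints. Put $G_k^i=g_k\tau(h\Theta_k^i)$ and $$s_d=\sum_{k=0}^{N-1}\Big(\sum_{i=1}^s h\Big[b_i\,\ell(G_k^i,\Xi_k^i)+\Big\langle\mu_k^i,\tfrac1h\tau^{-1}(g_k^{-1}G_k^i)-\sum_{j}a_{ij}\Xi_k^j\Big\rangle\Big]+h\Big\langle\mu_{k+1},\tfrac1h\tau^{-1}(g_k^{-1}g_{k+1})-\sum_j b_j\Xi_k^j\Big\rangle\Big).$$ With $f_k^j=(d\tau_{-h\Theta_k^j})^*\,G_k^j\frac{\partial\ell}{\partial g}(G_k^j,\Xi_k^j)$, the VPRK scheme consists of the equations, for $i=1,\dots,s$ and $k=0,\dots,N-1$, $$\tfrac1h\tau^{-1}(g_k^{-1}G_k^i)=\sum_j a_{ij}\Xi_k^j=\Theta_k^i,\qquad \tfrac1h\tau^{-1}(g_k^{-1}g_{k+1})=\sum_j b_j\Xi_k^j=\xi_{k+1},$$ $$(d\tau^{-1}_{h\xi_{k+1}})^*M_k^i=(d\tau^{-1}_{-h\xi_k})^*\mu_k+h\sum_j\Big(b_j(d\tau^{-1}_{h\Theta_k^j})^*-\tfrac{b_ja_{ji}}{b_i}(d\tau^{-1}_{h\xi_{k+1}})^*\Big)f_k^j,$$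 $$(d\tau^{-1}_{h\xi_{k+1}})^*\mu_{k+1}=(d\tau^{-1}_{-h\xi_k})^*\mu_k+h\sum_j b_j(d\tau^{-1}_{h\Theta_k^j})^*f_k^j,\qquad M_k^i=\frac{\partial\ell}{\partial\xi}(G_k^i,\Xi_k^i).$$ The initial velocity $\xi_0$ is any vector with $h\xi_0\in\mathcal U$. (1) Let $c_d\in\mathcal C_d(g_1,g_2)$ satisfy $h\Theta_k^i\in\mathcal U$ and $g_k^{-1}g_{k+1}\in\tau(\mathcal U)$ for $0\le k<N$, $1\le i\le s$, and let $h\xi_0\in\mathcal U$. Then $c_d$ is a critical point of $s_d:\mathcal C_d(g_1,g_2)\to\mathbb R$, i.e. $\mathbf ds_d(c_d)=0$, if and only if it satisfies the VPRK scheme, where the internal multipliers, which do not appear in the scheme, have the values $\mu_k^i=-h\,b_i\,f_k^i$ $(0\le k<N)$, and where $\mu_0$, on which $s_d$ does not depend, is assigned the unique value in $\mathfrak g^*$ for which the scheme holds (so the scheme is required to hold for exactly one choice of $\mu_0$). (2) Let $\mathcal I_{hp}=\{(g,\xi,\mu)\in G\times\mathfrak g\times\mathfrak g^*\mid\mu=\frac{\partial\ell}{\partial\xi}(g,\xi)\}$,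 and let $\omega_{\mathcal I_{hp}}$ be the pullback to $\mathcal I_{hp}$, under $(g,\xi,\mu)\mapsto(g,\mu)\in G\times\mathfrak g^*\cong T^*G$, of the canonical form $-\mathbf d\Theta$, $\Theta_{(g,\mu)}(\delta g,\delta\mu)=\langle\mu,g^{-1}\delta g\rangle$. A solution of the scheme has at time $t_k$ the momentum $p_k=(d\tau^{-1}_{-h\xi_k})^*\mu_k$, and is represented there by a point of $\mathcal I_{hp}$ lying over $(g_k,p_k)$. Let $F_h:\mathcal I_{hp}\to\mathcal I_{hp}$ be a discrete flow map defined by the scheme on an open set $U\subset\mathcal I_{hp}$: $F_h$ is smooth on $U$, and for each $z\in U$ lying over $(g,p)$ there is a solution of the one-step scheme $(N=1)$ with $h\xi_0$, $h\Theta_0^i\in\mathcal U$, $g_0^{-1}g_1\in\tau(\mathcal U)$, with stages $\Xi_0^i$ depending smoothly on $z$, such that $(g_0,p_0)=(g,p)$ and $F_h(z)$ lies over $(g_1,p_1)$. Then $F_h$ preserves $\omega_{\mathcal I_{hp}}$ on $U$: $(F_h^*\omega_{\mathcal I_{hp}})_z=(\omega_{\mathcal I_{hp}})_z$ for all $z\in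 U$. -/

import Mathlib

open Set Filter Topology
open scoped Manifold ContDiff

noncomputable section

namespace LieVPRK

/-! ### Exterior derivative of a one-form on a (boundaryless) manifold -/

section ExteriorDerivative

variable {F : Type*} [NormedAddCommGroup F] [NormedSpace ℝ F]
  {H : Type*} [TopologicalSpace H] (I : ModelWithCorners ℝ F H)
  {M : Type*} [TopologicalSpace M] [ChartedSpace H M]

/-- The local expression `(φ⁻¹)^* α` of a one-form `α` in the preferred chart `φ` around `x₀`. -/
def oneFormInChart (α : ∀ x : M, TangentSpace I x →L[ℝ] ℝ) (x₀ : M) : F → (F →L[ℝ] ℝ) :=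
  fun y => (α ((extChartAt I x₀).symm y)).comp (mfderiv 𝓘(ℝ, F) I (extChartAt I x₀).symm y)

/-- The exterior derivative `(dα)_{x₀}(v, w)` of a one-form `α`: if `A` is the local expression of
`α` in a chart, then `dα (v, w) = (DA v) w - (DA w) v` in that chart. -/
def dOneForm (α : ∀ x : M, TangentSpace I x →L[ℝ] ℝ) (x₀ : M) (v w : TangentSpace I x₀) : ℝ :=
  let φ := extChartAt I x₀
  let A := oneFormInChart I α x₀
  let v' : F := mfderiv I 𝓘(ℝ, F) φ x₀ v
  let w' : F := mfderiv I 𝓘(ℝ, F) φ x₀ w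
  fderiv ℝ A (φ x₀) v' w' - fderiv ℝ A (φ x₀) w' v'

end ExteriorDerivative

/-! In what follows `G` is a Lie group modelled on `E`. The Lie algebra `𝔤 = T_e G` is by
definition (of the tangent space) the vector space `E`; its dual `𝔤*` is `E →L[ℝ] ℝ`. -/

section Group

variable {E : Type*} [NormedAddCommGroup E] [NormedSpace ℝ E]
  {G : Type*} [TopologicalSpace G] [ChartedSpace E G] [Group G]

/-! ### The local chart `τ : 𝔤 → G` -/

/-- `τ` is a diffeomorphism of a neighbourhood of `0 ∈ 𝔤` (its source) onto a neighbourhood of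
`e ∈ G` (its target) with `τ 0 = e` and `τ ξ * τ (-ξ) = e`. -/
structure IsCanonicalChart (τ : OpenPartialHomeomorph E G) : Prop where
  zero_mem : (0 : E) ∈ τ.source
  map_zero : τ 0 = 1
  neg_mem : ∀ ξ ∈ τ.source, -ξ ∈ τ.source
  mul_neg : ∀ ξ ∈ τ.source, τ ξ * τ (-ξ) = 1
  smooth : ContMDiffOn 𝓘(ℝ, E) 𝓘(ℝ, E) ∞ τ τ.source
  smooth_symm : ContMDiffOn 𝓘(ℝ, E) 𝓘(ℝ, E) ∞ τ.symm τ.target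

/-- The right-trivialized tangent `dτ_ξ δ = TR_{τ(ξ)⁻¹} (Dτ(ξ) δ) ∈ T_e G`. -/
def dtau (τ : OpenPartialHomeomorph E G) (ξ : E) : E →L[ℝ] E :=
  mfderiv 𝓘(ℝ, E) 𝓘(ℝ, E) (fun y => τ y * (τ ξ)⁻¹) ξ

/-- The inverse right-trivialized tangent `dτ⁻¹_ξ δ = Dτ⁻¹(τ(ξ)) (TR_{τ(ξ)} δ)`. -/
def dtauInv (τ : OpenPartialHomeomorph E G) (ξ : E) : E →L[ℝ] E :=
  mfderiv 𝓘(ℝ, E) 𝓘(ℝ, E) (fun x : G => τ.symm (x * τ ξ)) 1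

/-- The dual `A^* : 𝔤* → 𝔤*` of a linear map `A : 𝔤 → 𝔤`. -/
def dual (A : E →L[ℝ] E) (μ : E →L[ℝ] ℝ) : E →L[ℝ] ℝ := μ.comp A

/-! ### Derivatives of the left-trivialized Lagrangian -/

/-- `∂ℓ/∂ξ (g, ξ) ∈ 𝔤*`. -/
def dXi (ℓ : G × E → ℝ) (g : G) (ξ : E) : E →L[ℝ] ℝ :=
  fderiv ℝ (fun ζ => ℓ (g, ζ)) ξ

/-- `g ∂ℓ/∂g (g, ξ) ∈ 𝔤*`, the left translation of `∂ℓ/∂g (g, ξ) ∈ T_g^* G` to the identity: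
`⟨g ∂ℓ/∂g, η⟩ = ⟨∂ℓ/∂g, TL_g η⟩`. -/
def gdG (ℓ : G × E → ℝ) (g : G) (ξ : E) : E →L[ℝ] ℝ :=
  mfderiv 𝓘(ℝ, E) 𝓘(ℝ, ℝ) (fun x : G => ℓ (g * x, ξ)) 1

/-! ### Discrete curves and the action sum -/

/-- A discrete curve `(g, μ, {Θ^i, Ξ^i, μ^i}_{i=1}^s) : {t_0, …, t_N} → (G × 𝔤*) × (𝔤 × 𝔤 × 𝔤*)^s`. -/
@[ext] structure DiscreteCurve (E : Type*) [NormedAddCommGroup E] [NormedSpace ℝ E]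
    (G : Type*) (N s : ℕ) where
  g : Fin (N + 1) → G
  mu : Fin (N + 1) → (E →L[ℝ] ℝ)
  Theta : Fin (N + 1) → Fin s → E
  Xi : Fin (N + 1) → Fin s → E
  muStage : Fin (N + 1) → Fin s → (E →L[ℝ] ℝ)

namespace DiscreteCurve

variable {N s : ℕ}

/-- The internal stage configuration `G_k^i = g_k τ(h Θ_k^i)`. -/
def stageG (τ : OpenPartialHomeomorph E G) (h : ℝ) (c : DiscreteCurve E G N s)
    (k : Fin N) (i : Fin s) : G :=
  c.g k.castSucc * τ (h • c.Theta k.castSucc i)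

/-- The curve stays where the chart `τ` can be used: `h Θ_k^i` lies in the domain of `τ`, and
`g_k⁻¹ g_{k+1}` in the domain of `τ⁻¹`. -/
def InChart (τ : OpenPartialHomeomorph E G) (h : ℝ) (c : DiscreteCurve E G N s) : Prop :=
  ∀ k : Fin N, (c.g k.castSucc)⁻¹ * c.g k.succ ∈ τ.target ∧
    ∀ i, h • c.Theta k.castSucc i ∈ τ.source

/-- The same curve with `μ_0` replaced by `ν`. -/
def withMuZero (c : DiscreteCurve E G N s) (ν : E →L[ℝ] ℝ) : DiscreteCurve E G N s :=
  { c with mu := Function.update c.mu 0 ν }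

/-- The path space `C_d(g₁, g₂)`. -/
def pathSpace (E : Type*) [NormedAddCommGroup E] [NormedSpace ℝ E] {G : Type*} (N s : ℕ)
    (g₁ g₂ : G) : Set (DiscreteCurve E G N s) :=
  {c | c.g 0 = g₁ ∧ c.g (Fin.last N) = g₂}

/-- The discrete Hamilton-Pontryagin action sum `s_d`. -/
def actionSum (τ : OpenPartialHomeomorph E G) (a : Fin s → Fin s → ℝ) (b : Fin s → ℝ) (h : ℝ)
    (ℓ : G × E → ℝ) (c : DiscreteCurve E G N s) : ℝ :=
  ∑ k : Fin N,
    ((∑ i : Fin s, h * (b i * ℓ (c.stageG τ h k i, c.Xi k.castSucc i)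
        + c.muStage k.castSucc i
            (h⁻¹ • τ.symm ((c.g k.castSucc)⁻¹ * c.stageG τ h k i)
              - ∑ j, a i j • c.Xi k.castSucc j)))
      + h * c.mu k.succ
          (h⁻¹ • τ.symm ((c.g k.castSucc)⁻¹ * c.g k.succ) - ∑ j, b j • c.Xi k.castSucc j))

/-- A smooth variation of `c₀` inside `C_d(g₁, g₂)`: all variables vary arbitrarily and
independently, except for the fixed endpoints. -/
structure IsVariation (g₁ g₂ : G) (c₀ : DiscreteCurve E G N s)
    (c : ℝ → DiscreteCurve E G N s) : Prop where
  at_zero : c 0 = c₀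
  mem : ∀ ε, c ε ∈ pathSpace E N s g₁ g₂
  smooth_g : ∀ k, ContMDiffAt 𝓘(ℝ, ℝ) 𝓘(ℝ, E) ∞ (fun ε => (c ε).g k) 0
  smooth_mu : ∀ k, ContDiffAt ℝ ∞ (fun ε => (c ε).mu k) 0
  smooth_Theta : ∀ k i, ContDiffAt ℝ ∞ (fun ε => (c ε).Theta k i) 0
  smooth_Xi : ∀ k i, ContDiffAt ℝ ∞ (fun ε => (c ε).Xi k i) 0
  smooth_muStage : ∀ k i, ContDiffAt ℝ ∞ (fun ε => (c ε).muStage k i) 0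

/-- `c₀` is a critical point of `s_d : C_d(g₁, g₂) → ℝ`, i.e. `d s_d (c₀) = 0`: the derivative of
`s_d` along every smooth variation of `c₀` in `C_d(g₁, g₂)` exists and vanishes. -/
def IsCritical (τ : OpenPartialHomeomorph E G) (a : Fin s → Fin s → ℝ) (b : Fin s → ℝ) (h : ℝ)
    (ℓ : G × E → ℝ) (g₁ g₂ : G) (c₀ : DiscreteCurve E G N s) : Prop :=
  ∀ c : ℝ → DiscreteCurve E G N s, IsVariation g₁ g₂ c₀ c →
    HasDerivAt (fun ε => actionSum τ a b h ℓ (c ε)) 0 0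

/-- The left-trivialized momentum `(dτ⁻¹_{-h ξ_k})^* μ_k` at time `t_k`. -/
def momentum (τ : OpenPartialHomeomorph E G) (h : ℝ) (c : DiscreteCurve E G N s)
    (ξ : Fin (N + 1) → E) (k : Fin (N + 1)) : E →L[ℝ] ℝ :=
  dual (dtauInv τ (-(h • ξ k))) (c.mu k)

/-- The stage force `(dτ_{-h Θ_k^j})^* G_k^j ∂ℓ/∂g (G_k^j, Ξ_k^j)`. -/
def force (τ : OpenPartialHomeomorph E G) (h : ℝ) (ℓ : G × E → ℝ) (c : DiscreteCurve E G N s)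
    (k : Fin N) (j : Fin s) : E →L[ℝ] ℝ :=
  dual (dtau τ (-(h • c.Theta k.castSucc j))) (gdG ℓ (c.stageG τ h k j) (c.Xi k.castSucc j))

/-- The VPRK scheme for the discrete curve `c`, with velocities `ξ_0, …, ξ_N` and stage momenta
`M_k^i`. -/
structure IsVPRK (τ : OpenPartialHomeomorph E G) (a : Fin s → Fin s → ℝ) (b : Fin s → ℝ) (h : ℝ)
    (ℓ : G × E → ℝ) (c : DiscreteCurve E G N s) (ξ : Fin (N + 1) → E)
    (M : Fin N → Fin s → (E →L[ℝ] ℝ)) : Prop where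
  internal : ∀ k i,
    h⁻¹ • τ.symm ((c.g k.castSucc)⁻¹ * c.stageG τ h k i) = ∑ j, a i j • c.Xi k.castSucc j ∧
      ∑ j, a i j • c.Xi k.castSucc j = c.Theta k.castSucc i
  external : ∀ k : Fin N,
    h⁻¹ • τ.symm ((c.g k.castSucc)⁻¹ * c.g k.succ) = ∑ j, b j • c.Xi k.castSucc j ∧
      ∑ j, b j • c.Xi k.castSucc j = ξ k.succ
  stageMomentum : ∀ k i,
    dual (dtauInv τ (h • ξ k.succ)) (M k i) = c.momentum τ h ξ k.castSucc
      + h • ∑ j, (b j • dual (dtauInv τ (h • c.Theta k.castSucc j)) (c.force τ h ℓ k j)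
          - (b j * a j i / b i) • dual (dtauInv τ (h • ξ k.succ)) (c.force τ h ℓ k j))
  externalMomentum : ∀ k : Fin N,
    dual (dtauInv τ (h • ξ k.succ)) (c.mu k.succ) = c.momentum τ h ξ k.castSucc
      + h • ∑ j, b j • dual (dtauInv τ (h • c.Theta k.castSucc j)) (c.force τ h ℓ k j)
  legendre : ∀ k i, M k i = dXi ℓ (c.stageG τ h k i) (c.Xi k.castSucc i)

/-- `c` satisfies the VPRK scheme with initial velocity `ξ_0`. The quantities `ξ_1, …, ξ_N` and
`M_k^i` are determined by the scheme. -/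
def SatisfiesVPRK (τ : OpenPartialHomeomorph E G) (a : Fin s → Fin s → ℝ) (b : Fin s → ℝ) (h : ℝ)
    (ℓ : G × E → ℝ) (ξ₀ : E) (c : DiscreteCurve E G N s) : Prop :=
  ∃ (ξ : Fin (N + 1) → E) (M : Fin N → Fin s → (E →L[ℝ] ℝ)),
    ξ 0 = ξ₀ ∧ IsVPRK τ a b h ℓ c ξ M

end DiscreteCurve

/-! ### The admissible space and its symplectic form -/

/-- The admissible space `I_hp = {(g, ξ, μ) ∈ G × 𝔤 × 𝔤* | μ = ∂ℓ/∂ξ (g, ξ)}`. -/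
def admissibleSpace (ℓ : G × E → ℝ) : Set (G × E × (E →L[ℝ] ℝ)) :=
  {z | z.2.2 = dXi ℓ z.1 z.2.1}

/-- `I_hp` is the graph of `∂ℓ/∂ξ`; as a manifold it is identified with `G × 𝔤` through the graph
chart `(g, ξ, μ) ↦ (g, ξ)`. -/
def graphChart (ℓ : G × E → ℝ) : admissibleSpace ℓ ≃ G × E where
  toFun z := (z.1.1, z.1.2.1)
  invFun x := ⟨(x.1, x.2, dXi ℓ x.1 x.2), rfl⟩
  left_inv := by
    rintro ⟨⟨g, ξ, μ⟩, hz⟩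
    have hμ : μ = dXi ℓ g ξ := hz
    subst hμ
    rfl
  right_inv _ := rfl

/-- The projection `I_hp → T^* G ≅ G × 𝔤*`, `(g, ξ, μ) ↦ (g, μ)`, in the graph chart (that is, the
left-trivialized Legendre transform). -/
def projHp (ℓ : G × E → ℝ) (x : G × E) : G × (E →L[ℝ] ℝ) := (x.1, dXi ℓ x.1 x.2)

/-- The canonical one-form of `T^* G` in the left trivialization `G × 𝔤*`:
`Θ_{(g, μ)} (δg, δμ) = ⟨μ, g⁻¹ δg⟩`. -/
def canonicalOneForm (x : G × (E →L[ℝ] ℝ)) :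
    TangentSpace (𝓘(ℝ, E).prod 𝓘(ℝ, E →L[ℝ] ℝ)) x →L[ℝ] ℝ :=
  x.2.comp ((mfderiv 𝓘(ℝ, E) 𝓘(ℝ, E) (fun y : G => x.1⁻¹ * y) x.1).comp
    (mfderiv (𝓘(ℝ, E).prod 𝓘(ℝ, E →L[ℝ] ℝ)) 𝓘(ℝ, E) Prod.fst x))

/-- The canonical symplectic form `Ω = -dΘ` of `T^* G` in the left trivialization. -/
def canonicalTwoForm (x : G × (E →L[ℝ] ℝ))
    (v w : TangentSpace (𝓘(ℝ, E).prod 𝓘(ℝ, E →L[ℝ] ℝ)) x) : ℝ :=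
  -dOneForm (𝓘(ℝ, E).prod 𝓘(ℝ, E →L[ℝ] ℝ)) canonicalOneForm x v w

/-- The form `ω_{I_hp}`, the pullback of `Ω` to `I_hp`, in the graph chart. -/
def omegaHp (ℓ : G × E → ℝ) (x : G × E) (v w : TangentSpace (𝓘(ℝ, E).prod 𝓘(ℝ, E)) x) : ℝ :=
  let D := mfderiv (𝓘(ℝ, E).prod 𝓘(ℝ, E)) (𝓘(ℝ, E).prod 𝓘(ℝ, E →L[ℝ] ℝ)) (projHp ℓ) x
  canonicalTwoForm (projHp ℓ x) (D v) (D w)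

/-- A self-map of `I_hp` in the graph chart. -/
def inGraphChart (ℓ : G × E → ℝ) (F : admissibleSpace ℓ → admissibleSpace ℓ) : G × E → G × E :=
  fun x => graphChart ℓ (F ((graphChart ℓ).symm x))

/-- `F` preserves `ω_{I_hp}` at the points of `U`: `(F^* ω)_z (v, w) = ω_z (v, w)`. -/
def PreservesOmegaHp (ℓ : G × E → ℝ) (U : Set (admissibleSpace ℓ))
    (F : admissibleSpace ℓ → admissibleSpace ℓ) : Prop :=
  ∀ x : G × E, (graphChart ℓ).symm x ∈ U →
    ∀ v w : TangentSpace (𝓘(ℝ, E).prod 𝓘(ℝ, E)) x,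
      let D := mfderiv (𝓘(ℝ, E).prod 𝓘(ℝ, E)) (𝓘(ℝ, E).prod 𝓘(ℝ, E)) (inGraphChart ℓ F) x
      omegaHp ℓ (inGraphChart ℓ F x) (D v) (D w) = omegaHp ℓ x v w

/-! ### The discrete flow map -/

/-- `F` is a smooth discrete flow map `F_h : I_hp → I_hp` of the VPRK scheme on the open set `U`:
for every `z = (g, ·, p) ∈ U` there is a one-step solution of the scheme, whose stages depend
smoothly on `z`, that leads from `g_0 = g` with momentum `(dτ⁻¹_{-h ξ_0})^* μ_0 = p` to the base
point `g_1 = g'` and the momentum `(dτ⁻¹_{-h ξ_1})^* μ_1 = p'` of `F z = (g', ·, p')`. -/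
structure IsDiscreteFlow {s : ℕ} (τ : OpenPartialHomeomorph E G) (a : Fin s → Fin s → ℝ)
    (b : Fin s → ℝ) (h : ℝ) (ℓ : G × E → ℝ) (U : Set (admissibleSpace ℓ))
    (F : admissibleSpace ℓ → admissibleSpace ℓ) : Prop where
  smooth : ContMDiffOn (𝓘(ℝ, E).prod 𝓘(ℝ, E)) (𝓘(ℝ, E).prod 𝓘(ℝ, E)) ∞ (inGraphChart ℓ F)
    ((graphChart ℓ).symm ⁻¹' U)
  scheme : ∃ (c : admissibleSpace ℓ → DiscreteCurve E G 1 s) (ξ : admissibleSpace ℓ → Fin 2 → E)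
    (M : admissibleSpace ℓ → Fin 1 → Fin s → (E →L[ℝ] ℝ)),
    (∀ i, ContMDiffOn (𝓘(ℝ, E).prod 𝓘(ℝ, E)) 𝓘(ℝ, E) ∞
      (fun x => (c ((graphChart ℓ).symm x)).Xi 0 i) ((graphChart ℓ).symm ⁻¹' U)) ∧
    ∀ z ∈ U,
      (c z).InChart τ h ∧ h • ξ z 0 ∈ τ.source ∧
      (c z).IsVPRK τ a b h ℓ (ξ z) (M z) ∧
      (c z).g 0 = z.1.1 ∧ (c z).momentum τ h (ξ z) 0 = z.1.2.2 ∧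
      (c z).g 1 = (F z).1.1 ∧ (c z).momentum τ h (ξ z) 1 = (F z).1.2.2

end Group

end LieVPRK

end

/-! All derivatives are left-trivialized: the derivative of a `G`-valued map `g` at `x` is that of
`y ↦ g(x)⁻¹ g(y)`, which passes through the identity, where multiplication linearizes to addition.
The relation `τ(-ξ) = τ(ξ)⁻¹` exchanges left and right trivialization at the cost of a sign, and
`dtau_neg_comp_dtauInv` absorbs the adjoint maps into `dtau` and `dtauInv`.

Part (1). By `hasDerivAt_actionSum` the derivative of the action is a linear form in the variations,
which are independent apart from the fixed endpoints, so criticality means that every coefficient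
vanishes (`forall_variation_eq_zero_iff`). The multipliers give the stage equations, `δΘ` fixes the
internal multipliers, `δΞ` gives the stage momenta, and `δg` at the interior nodes gives the
momentum balance of every step but the initial one. The balance of step zero is no Euler-Lagrange
equation. It determines `μ_0`, because `dtauInv` is invertible (`satisfiesVPRK_and_muStage_iff`).

Part (2). The action of one step, restricted to solutions, is a generating function. The constraints
vanish there, and by `hasFDerivAt_stepAction` its differential consists of boundary terms only:
`⟨p₁, g₁⁻¹ dg₁⟩ - ⟨p₀, g₀⁻¹ dg₀⟩`, which is `F^*θ - θ` for the pullback `θ` of the canonical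
one-form. Symmetry of second derivatives makes this difference closed. Naturality of the exterior
derivative (`exists_hasFDerivAt_pullback`) then gives `F^*ω = ω`. -/

noncomputable section

namespace LieVPRK

/-! ### Derivatives of maps between manifolds as linear maps of the model spaces -/

section ModelDeriv

variable {F₁ : Type*} [NormedAddCommGroup F₁] [NormedSpace ℝ F₁]
  {F₂ : Type*} [NormedAddCommGroup F₂] [NormedSpace ℝ F₂]
  {F₃ : Type*} [NormedAddCommGroup F₃] [NormedSpace ℝ F₃]
  {H₁ : Type*} [TopologicalSpace H₁] {I₁ : ModelWithCorners ℝ F₁ H₁}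
  {H₂ : Type*} [TopologicalSpace H₂] {I₂ : ModelWithCorners ℝ F₂ H₂}
  {H₃ : Type*} [TopologicalSpace H₃] {I₃ : ModelWithCorners ℝ F₃ H₃}
  {M₁ : Type*} [TopologicalSpace M₁] [ChartedSpace H₁ M₁]
  {M₂ : Type*} [TopologicalSpace M₂] [ChartedSpace H₂ M₂]
  {M₃ : Type*} [TopologicalSpace M₃] [ChartedSpace H₃ M₃]

variable (I₁ I₂) in
/-- `HasMFDerivAt` with the derivative given as a linear map of the model vector spaces. -/
def HasModelDerivAt (f : M₁ → M₂) (x : M₁) (A : F₁ →L[ℝ] F₂) : Prop :=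
  HasMFDerivAt I₁ I₂ f x A

/-- The base point `y` is kept separate from `f x` because the two often agree only after rewriting,
for instance when a product of group elements simplifies to `1`. -/
theorem HasModelDerivAt.comp {f : M₁ → M₂} {g : M₂ → M₃} {x : M₁} {y : M₂}
    {A : F₁ →L[ℝ] F₂} {B : F₂ →L[ℝ] F₃}
    (hg : HasModelDerivAt I₂ I₃ g y B) (hf : HasModelDerivAt I₁ I₂ f x A) (hy : f x = y) :
    HasModelDerivAt I₁ I₃ (fun t => g (f t)) x (B.comp A) := by
  subst hy
  exact HasMFDerivAt.comp x hg hf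

theorem HasModelDerivAt.congr {f g : M₁ → M₂} {x : M₁} {A : F₁ →L[ℝ] F₂}
    (hf : HasModelDerivAt I₁ I₂ f x A) (h : g =ᶠ[𝓝 x] f) : HasModelDerivAt I₁ I₂ g x A := by
  exact HasMFDerivAt.congr_of_eventuallyEq hf h

theorem HasModelDerivAt.unique {f : M₁ → M₂} {x : M₁} {A B : F₁ →L[ℝ] F₂}
    (hA : HasModelDerivAt I₁ I₂ f x A) (hB : HasModelDerivAt I₁ I₂ f x B) : A = B :=
  hasMFDerivAt_unique hA hB

theorem HasModelDerivAt.prodMk {f : M₁ → M₂} {g : M₁ → M₃} {x : M₁}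
    {A : F₁ →L[ℝ] F₂} {B : F₁ →L[ℝ] F₃}
    (hf : HasModelDerivAt I₁ I₂ f x A) (hg : HasModelDerivAt I₁ I₃ g x B) :
    HasModelDerivAt I₁ (I₂.prod I₃) (fun t => (f t, g t)) x (A.prod B) :=
  HasMFDerivAt.prodMk hf hg

theorem hasModelDerivAt_const (y : M₂) (x : M₁) :
    HasModelDerivAt I₁ I₂ (fun _ : M₁ => y) x 0 :=
  hasMFDerivAt_const y x

theorem hasModelDerivAt_id (x : M₁) :
    HasModelDerivAt I₁ I₁ (fun y : M₁ => y) x (ContinuousLinearMap.id ℝ F₁) :=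
  hasMFDerivAt_id x

theorem _root_.MDifferentiableAt.hasModelDerivAt {f : M₁ → M₂} {x : M₁}
    (hf : MDifferentiableAt I₁ I₂ f x) : HasModelDerivAt I₁ I₂ f x (mfderiv I₁ I₂ f x) :=
  hf.hasMFDerivAt

theorem HasModelDerivAt.mfderiv_eq {f : M₁ → M₂} {x : M₁} {A : F₁ →L[ℝ] F₂}
    (hf : HasModelDerivAt I₁ I₂ f x A) : mfderiv I₁ I₂ f x = A :=
  HasMFDerivAt.mfderiv hf

theorem HasModelDerivAt.mdifferentiableAt {f : M₁ → M₂} {x : M₁} {A : F₁ →L[ℝ] F₂}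
    (hf : HasModelDerivAt I₁ I₂ f x A) : MDifferentiableAt I₁ I₂ f x :=
  HasMFDerivAt.mdifferentiableAt hf

theorem HasModelDerivAt.continuousAt {f : M₁ → M₂} {x : M₁} {A : F₁ →L[ℝ] F₂}
    (hf : HasModelDerivAt I₁ I₂ f x A) : ContinuousAt f x :=
  HasMFDerivAt.continuousAt hf

theorem hasModelDerivAt_iff_hasFDerivAt {f : F₁ → F₂} {x : F₁} {A : F₁ →L[ℝ] F₂} :
    HasModelDerivAt 𝓘(ℝ, F₁) 𝓘(ℝ, F₂) f x A ↔ HasFDerivAt f A x :=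
  hasMFDerivAt_iff_hasFDerivAt

end ModelDeriv

/-! ### The adjoint action and left-trivialized derivatives. -/

section Group

variable {E : Type*} [NormedAddCommGroup E] [NormedSpace ℝ E]
  {G : Type*} [TopologicalSpace G] [ChartedSpace E G] [Group G]
  {F : Type*} [NormedAddCommGroup F] [NormedSpace ℝ F]
  {H : Type*} [TopologicalSpace H] {I : ModelWithCorners ℝ F H}
  {X : Type*} [TopologicalSpace X] [ChartedSpace H X]

/-- The adjoint representation, `Ad_g = T_e (x ↦ g x g⁻¹)`. -/
def Ad (g : G) : E →L[ℝ] E := mfderiv 𝓘(ℝ, E) 𝓘(ℝ, E) (fun x : G => g * x * g⁻¹) 1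

variable (I) in
/-- `A` is the left-trivialized derivative `v ↦ g(x)⁻¹ Dg(x) v` of `g` at `x`. -/
def HasLeftDerivAt (g : X → G) (x : X) (A : F →L[ℝ] E) : Prop :=
  HasModelDerivAt I 𝓘(ℝ, E) (fun y => (g x)⁻¹ * g y) x A

variable (I) in
/-- The left-trivialized derivative `v ↦ g(x)⁻¹ Dg(x) v`. -/
def leftDeriv (g : X → G) (x : X) : F →L[ℝ] E :=
  mfderiv I 𝓘(ℝ, E) (fun y => (g x)⁻¹ * g y) x

theorem HasLeftDerivAt.leftDeriv_eq {g : X → G} {x : X} {A : F →L[ℝ] E}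
    (hg : HasLeftDerivAt I g x A) : leftDeriv I g x = A := by
  have hg' : HasModelDerivAt I 𝓘(ℝ, E) (fun y => (g x)⁻¹ * g y) x A := hg
  exact hg'.mfderiv_eq

theorem leftDeriv_const (g : G) (x : X) : leftDeriv (E := E) I (fun _ : X => g) x = 0 :=
  (hasModelDerivAt_const (I₁ := I) (I₂ := 𝓘(ℝ, E)) (g⁻¹ * g) x).mfderiv_eq

variable [LieGroup 𝓘(ℝ, E) ∞ G]

/-! ### Calculus of maps into a Lie group at points mapped to the identity -/

/-- On each of the axes `G × {1}` and `{1} × G` multiplication is the identity, and a linear map on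
`E × E` is determined by its restrictions to the two axes. -/
theorem hasModelDerivAt_mul_one :
    HasModelDerivAt (𝓘(ℝ, E).prod 𝓘(ℝ, E)) 𝓘(ℝ, E) (fun p : G × G => p.1 * p.2) (1, 1)
      (ContinuousLinearMap.fst ℝ E E + ContinuousLinearMap.snd ℝ E E) := by
  have hm : MDifferentiableAt (𝓘(ℝ, E).prod 𝓘(ℝ, E)) 𝓘(ℝ, E) (fun p : G × G => p.1 * p.2)
      (1, 1) := ((contMDiff_mul 𝓘(ℝ, E) ∞) _).mdifferentiableAt (by simp)
  have h := MDifferentiableAt.hasModelDerivAt hm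
  set A : E × E →L[ℝ] E := mfderiv (𝓘(ℝ, E).prod 𝓘(ℝ, E)) 𝓘(ℝ, E)
    (fun p : G × G => p.1 * p.2) (1, 1)
  have h1 := (HasModelDerivAt.comp h ((hasModelDerivAt_id (I₁ := 𝓘(ℝ, E)) (1 : G)).prodMk
    (hasModelDerivAt_const (I₂ := 𝓘(ℝ, E)) (1 : G) (1 : G))) rfl)
  have h2 := (HasModelDerivAt.comp h ((hasModelDerivAt_const (I₂ := 𝓘(ℝ, E)) (1 : G) (1 : G)).prodMk
    (hasModelDerivAt_id (I₁ := 𝓘(ℝ, E)) (1 : G))) rfl)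
  simp only [mul_one, one_mul] at h1 h2
  have e1 := h1.unique (hasModelDerivAt_id (I₁ := 𝓘(ℝ, E)) (1 : G))
  have e2 := h2.unique (hasModelDerivAt_id (I₁ := 𝓘(ℝ, E)) (1 : G))
  have : A = ContinuousLinearMap.fst ℝ E E + ContinuousLinearMap.snd ℝ E E := by
    ext1
    · exact e1.trans (by ext; simp)
    · exact e2.trans (by ext; simp)
  rw [← this]
  exact h

theorem HasModelDerivAt.mul_of_eq_one {u v : X → G} {x : X} {A B : F →L[ℝ] E}
    (hu : HasModelDerivAt I 𝓘(ℝ, E) u x A) (hv : HasModelDerivAt I 𝓘(ℝ, E) v x B)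
    (hu1 : u x = 1) (hv1 : v x = 1) :
    HasModelDerivAt I 𝓘(ℝ, E) (fun y => u y * v y) x (A + B) := by
  have := HasModelDerivAt.comp hasModelDerivAt_mul_one (hu.prodMk hv) (by rw [hu1, hv1])
  have e : A + B = (ContinuousLinearMap.fst ℝ E E + ContinuousLinearMap.snd ℝ E E).comp
      (A.prod B) := by ext; simp
  rw [e]
  exact this

/-- Inversion is differentiable, so the product rule applies to the constant map `u u⁻¹ = 1` and
forces the derivative of `u⁻¹` to be `-A`. -/
theorem HasModelDerivAt.inv_of_eq_one {u : X → G} {x : X} {A : F →L[ℝ] E}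
    (hu : HasModelDerivAt I 𝓘(ℝ, E) u x A) (hu1 : u x = 1) :
    HasModelDerivAt I 𝓘(ℝ, E) (fun y => (u y)⁻¹) x (-A) := by
  have hi : MDifferentiableAt 𝓘(ℝ, E) 𝓘(ℝ, E) (fun p : G => p⁻¹) 1 :=
    ((contMDiff_inv 𝓘(ℝ, E) ∞) _).mdifferentiableAt (by simp)
  have h := HasModelDerivAt.comp (MDifferentiableAt.hasModelDerivAt hi) hu hu1
  have h2 := HasModelDerivAt.mul_of_eq_one hu h hu1 (by simp [hu1])
  simp only [mul_inv_cancel] at h2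
  have h3 := h2.unique (hasModelDerivAt_const (I₂ := 𝓘(ℝ, E)) (1 : G) x)
  rw [eq_neg_of_add_eq_zero_right h3] at h
  exact h

theorem hasModelDerivAt_conj (g : G) :
    HasModelDerivAt 𝓘(ℝ, E) 𝓘(ℝ, E) (fun x : G => g * x * g⁻¹) 1 (Ad (E := E) g) := by
  apply MDifferentiableAt.hasModelDerivAt
  have : ContMDiff 𝓘(ℝ, E) 𝓘(ℝ, E) ∞ (fun x : G => g * x * g⁻¹) :=
    (contMDiff_const.mul contMDiff_id).mul contMDiff_const
  exact (this 1).mdifferentiableAt (by simp)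

/-! ### Left logarithmic derivatives -/

theorem mdifferentiableAt_mul_left (g x : G) :
    MDifferentiableAt 𝓘(ℝ, E) 𝓘(ℝ, E) (fun y : G => g * y) x :=
  ((contMDiff_const.mul contMDiff_id : ContMDiff 𝓘(ℝ, E) 𝓘(ℝ, E) ∞ (fun y : G => g * y)) x
    ).mdifferentiableAt (by simp)

theorem mdifferentiableAt_mul_right (g x : G) :
    MDifferentiableAt 𝓘(ℝ, E) 𝓘(ℝ, E) (fun y : G => y * g) x :=
  ((contMDiff_id.mul contMDiff_const : ContMDiff 𝓘(ℝ, E) 𝓘(ℝ, E) ∞ (fun y : G => y * g)) x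
    ).mdifferentiableAt (by simp)

theorem _root_.MDifferentiableAt.hasLeftDerivAt {g : X → G} {x : X}
    (hg : MDifferentiableAt I 𝓘(ℝ, E) g x) :
    HasLeftDerivAt I g x (leftDeriv (E := E) I g x) := by
  have h : MDifferentiableAt I 𝓘(ℝ, E) (fun y => (g x)⁻¹ * g y) x :=
    (mdifferentiableAt_mul_left (g x)⁻¹ (g x)).comp x hg
  exact h.hasModelDerivAt

theorem HasLeftDerivAt.mdifferentiableAt {g : X → G} {x : X} {A : F →L[ℝ] E}
    (hg : HasLeftDerivAt I g x A) : MDifferentiableAt I 𝓘(ℝ, E) g x := by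
  have hg' : HasModelDerivAt I 𝓘(ℝ, E) (fun y => (g x)⁻¹ * g y) x A := hg
  have := (mdifferentiableAt_mul_left (E := E) (g x) ((g x)⁻¹ * g x)).comp x
    hg'.mdifferentiableAt
  convert this using 1
  ext y
  simp

/-- The translated product factors as `[k(x)⁻¹ (g(x)⁻¹ g(y)) k(x)] · [k(x)⁻¹ k(y)]`. Both factors
pass through `1`, so their derivatives add, and the conjugation contributes the adjoint map. -/
theorem HasLeftDerivAt.mul {g k : X → G} {x : X} {A B : F →L[ℝ] E}
    (hg : HasLeftDerivAt I g x A) (hk : HasLeftDerivAt I k x B) :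
    HasLeftDerivAt I (fun y => g y * k y) x ((Ad (k x)⁻¹).comp A + B) := by
  have h := HasModelDerivAt.mul_of_eq_one
    (HasModelDerivAt.comp (hasModelDerivAt_conj (k x)⁻¹) hg (by simp)) hk (by simp) (by simp)
  refine h.congr (Eventually.of_forall fun y => ?_)
  simp [mul_assoc]

theorem HasLeftDerivAt.inv_mul {g k : X → G} {x : X} {A B : F →L[ℝ] E}
    (hg : HasLeftDerivAt I g x A) (hk : HasLeftDerivAt I k x B) :
    HasLeftDerivAt I (fun y => (g y)⁻¹ * k y) x
      (B - (Ad (((g x)⁻¹ * k x)⁻¹)).comp A) := by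
  have h := HasModelDerivAt.mul_of_eq_one
    (HasModelDerivAt.comp (hasModelDerivAt_conj ((g x)⁻¹ * k x)⁻¹)
      (HasModelDerivAt.inv_of_eq_one hg (by simp)) (by simp)) hk (by simp) (by simp)
  have e : B - (Ad (((g x)⁻¹ * k x)⁻¹)).comp A
      = (Ad (((g x)⁻¹ * k x)⁻¹)).comp (-A) + B := by
    rw [ContinuousLinearMap.comp_neg]; abel
  unfold HasLeftDerivAt
  rw [e]
  refine h.congr (Eventually.of_forall fun y => ?_)
  simp [mul_assoc]

end Group

section Chart

variable {E : Type*} [NormedAddCommGroup E] [NormedSpace ℝ E]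
  {G : Type*} [TopologicalSpace G] [ChartedSpace E G] [Group G]
  {F : Type*} [NormedAddCommGroup F] [NormedSpace ℝ F]
  {H : Type*} [TopologicalSpace H] {I : ModelWithCorners ℝ F H}
  {X : Type*} [TopologicalSpace X] [ChartedSpace H X]
  {τ : OpenPartialHomeomorph E G}

/-! ### The chart `τ` and its trivialized tangents -/

theorem IsCanonicalChart.map_neg (hτ : IsCanonicalChart τ) {ξ : E} (hξ : ξ ∈ τ.source) :
    τ (-ξ) = (τ ξ)⁻¹ :=
  (inv_eq_of_mul_eq_one_right (hτ.mul_neg ξ hξ)).symm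

theorem IsCanonicalChart.symm_inv (hτ : IsCanonicalChart τ) {x : G} (hx : x ∈ τ.target) :
    τ.symm x⁻¹ = -τ.symm x := by
  have h := τ.left_inv (hτ.neg_mem _ (τ.map_target hx))
  rwa [hτ.map_neg (τ.map_target hx), τ.right_inv hx] at h

theorem IsCanonicalChart.mdifferentiableAt (hτ : IsCanonicalChart τ) {ξ : E}
    (hξ : ξ ∈ τ.source) : MDifferentiableAt 𝓘(ℝ, E) 𝓘(ℝ, E) τ ξ :=
  (hτ.smooth.contMDiffAt (τ.open_source.mem_nhds hξ)).mdifferentiableAt (by simp)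

theorem IsCanonicalChart.mdifferentiableAt_symm (hτ : IsCanonicalChart τ) {x : G}
    (hx : x ∈ τ.target) : MDifferentiableAt 𝓘(ℝ, E) 𝓘(ℝ, E) τ.symm x :=
  (hτ.smooth_symm.contMDiffAt (τ.open_target.mem_nhds hx)).mdifferentiableAt (by simp)

variable [LieGroup 𝓘(ℝ, E) ∞ G]

theorem hasModelDerivAt_dtau (hτ : IsCanonicalChart τ) {ξ : E} (hξ : ξ ∈ τ.source) :
    HasModelDerivAt 𝓘(ℝ, E) 𝓘(ℝ, E) (fun y => τ y * (τ ξ)⁻¹) ξ (dtau τ ξ) := by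
  have h : MDifferentiableAt 𝓘(ℝ, E) 𝓘(ℝ, E) (fun y => τ y * (τ ξ)⁻¹) ξ :=
    (mdifferentiableAt_mul_right (τ ξ)⁻¹ (τ ξ)).comp ξ (hτ.mdifferentiableAt hξ)
  exact h.hasModelDerivAt

theorem hasModelDerivAt_dtauInv (hτ : IsCanonicalChart τ) {ξ : E} (hξ : ξ ∈ τ.source) :
    HasModelDerivAt 𝓘(ℝ, E) 𝓘(ℝ, E) (fun x : G => τ.symm (x * τ ξ)) 1 (dtauInv τ ξ) := by
  have h : MDifferentiableAt 𝓘(ℝ, E) 𝓘(ℝ, E) (fun x : G => τ.symm (x * τ ξ)) 1 :=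
    MDifferentiableAt.comp_of_eq 1 (hτ.mdifferentiableAt_symm (τ.map_source hξ))
      (mdifferentiableAt_mul_right (τ ξ) 1) (one_mul _)
  exact h.hasModelDerivAt

theorem hasModelDerivAt_neg (ξ : E) :
    HasModelDerivAt 𝓘(ℝ, E) 𝓘(ℝ, E) (fun y : E => -y) ξ (-ContinuousLinearMap.id ℝ E) :=
  hasModelDerivAt_iff_hasFDerivAt.2 (hasFDerivAt_id ξ).neg

/-- Since `τ(ξ)⁻¹ τ(y) = (τ(-y) τ(-ξ)⁻¹)⁻¹`, the minus signs from inversion and from `y ↦ -y`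
cancel. -/
theorem hasLeftDerivAt_tau (hτ : IsCanonicalChart τ) {ξ : E} (hξ : ξ ∈ τ.source) :
    HasLeftDerivAt 𝓘(ℝ, E) τ ξ (dtau τ (-ξ)) := by
  have h := HasModelDerivAt.comp (hasModelDerivAt_dtau hτ (hτ.neg_mem ξ hξ))
    (hasModelDerivAt_neg ξ) rfl
  have h' := HasModelDerivAt.inv_of_eq_one h (by simp)
  have e : -(dtau τ (-ξ)).comp (-ContinuousLinearMap.id ℝ E) = dtau τ (-ξ) := by
    ext; simp
  rw [e] at h'
  refine h'.congr ?_
  filter_upwards [τ.open_source.mem_nhds hξ] with y hy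
  simp [hτ.map_neg hy, hτ.map_neg hξ]

/-- The counterpart for the inverse chart rests on `τ⁻¹(τ(ξ) x) = -τ⁻¹(x⁻¹ τ(-ξ))`, valid for `x`
near `1`. -/
theorem hasModelDerivAt_symm_mul (hτ : IsCanonicalChart τ) {ξ : E} (hξ : ξ ∈ τ.source) :
    HasModelDerivAt 𝓘(ℝ, E) 𝓘(ℝ, E) (fun x : G => τ.symm (τ ξ * x)) 1 (dtauInv τ (-ξ)) := by
  have hi := HasModelDerivAt.inv_of_eq_one (hasModelDerivAt_id (I₁ := 𝓘(ℝ, E)) (1 : G)) rfl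
  have h := HasModelDerivAt.comp (hasModelDerivAt_neg _)
    (HasModelDerivAt.comp (hasModelDerivAt_dtauInv hτ (hτ.neg_mem ξ hξ)) hi (by simp)) rfl
  have e : (-ContinuousLinearMap.id ℝ E).comp
      ((dtauInv τ (-ξ)).comp (-ContinuousLinearMap.id ℝ E)) = dtauInv τ (-ξ) := by
    ext; simp
  rw [e] at h
  refine h.congr ?_
  have hc : ContinuousAt (fun x : G => τ ξ * x) 1 :=
    (mdifferentiableAt_mul_left (E := E) (τ ξ) (1 : G)).continuousAt
  have : ∀ᶠ x : G in 𝓝 1, τ ξ * x ∈ τ.target := by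
    apply hc.eventually_mem
    rw [mul_one]
    exact τ.open_target.mem_nhds (τ.map_source hξ)
  filter_upwards [this] with x hx
  rw [hτ.map_neg hξ, ← mul_inv_rev, hτ.symm_inv hx, neg_neg]

theorem dtauInv_comp_dtau (hτ : IsCanonicalChart τ) {ξ : E} (hξ : ξ ∈ τ.source) :
    (dtauInv τ ξ).comp (dtau τ ξ) = ContinuousLinearMap.id ℝ E := by
  have h := HasModelDerivAt.comp (hasModelDerivAt_dtauInv hτ hξ) (hasModelDerivAt_dtau hτ hξ)
    (by simp)
  refine h.unique ((hasModelDerivAt_id ξ).congr ?_)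
  filter_upwards [τ.open_source.mem_nhds hξ] with y hy
  simp [τ.left_inv hy]

theorem eventually_mul_mem_target {ξ : E} (hξ : ξ ∈ τ.source) :
    ∀ᶠ x : G in 𝓝 1, x * τ ξ ∈ τ.target := by
  have hc : ContinuousAt (fun x : G => x * τ ξ) 1 :=
    (mdifferentiableAt_mul_right (E := E) (τ ξ) (1 : G)).continuousAt
  apply hc.eventually_mem
  rw [one_mul]
  exact τ.open_target.mem_nhds (τ.map_source hξ)

theorem dtau_comp_dtauInv (hτ : IsCanonicalChart τ) {ξ : E} (hξ : ξ ∈ τ.source) :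
    (dtau τ ξ).comp (dtauInv τ ξ) = ContinuousLinearMap.id ℝ E := by
  have h := HasModelDerivAt.comp (hasModelDerivAt_dtau hτ hξ) (hasModelDerivAt_dtauInv hτ hξ)
    (by simp [τ.left_inv hξ])
  refine h.unique ((hasModelDerivAt_id (I₁ := 𝓘(ℝ, E)) (1 : G)).congr ?_)
  filter_upwards [eventually_mul_mem_target hξ] with x hx
  simp [τ.right_inv hx]

/-- The composite differentiates `x ↦ τ(ξ)⁻¹ τ(τ⁻¹(x τ(ξ)))`, which near `1` is conjugation by
`τ(ξ)⁻¹`. -/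
theorem dtau_neg_comp_dtauInv (hτ : IsCanonicalChart τ) {ξ : E} (hξ : ξ ∈ τ.source) :
    (dtau τ (-ξ)).comp (dtauInv τ ξ) = Ad (τ ξ)⁻¹ := by
  have h := HasModelDerivAt.comp (hasLeftDerivAt_tau hτ hξ) (hasModelDerivAt_dtauInv hτ hξ)
    (by simp [τ.left_inv hξ])
  refine h.unique ((hasModelDerivAt_conj (τ ξ)⁻¹).congr ?_)
  filter_upwards [eventually_mul_mem_target hξ] with x hx
  simp [τ.right_inv hx, mul_assoc]

theorem dtauInv_neg_comp_Ad (hτ : IsCanonicalChart τ) {ξ : E} (hξ : ξ ∈ τ.source) :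
    (dtauInv τ (-ξ)).comp (Ad (τ ξ)⁻¹) = dtauInv τ ξ := by
  rw [← dtau_neg_comp_dtauInv hτ hξ, ← ContinuousLinearMap.comp_assoc,
    dtauInv_comp_dtau hτ (hτ.neg_mem ξ hξ), ContinuousLinearMap.id_comp]

theorem HasModelDerivAt.tau (hτ : IsCanonicalChart τ) {f : X → E} {x : X} {A : F →L[ℝ] E}
    (hf : HasModelDerivAt I 𝓘(ℝ, E) f x A) (hx : f x ∈ τ.source) :
    HasLeftDerivAt I (fun y => τ (f y)) x ((dtau τ (-f x)).comp A) :=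
  (show HasModelDerivAt 𝓘(ℝ, E) 𝓘(ℝ, E) (fun y => (τ (f x))⁻¹ * τ y) (f x) _ from
    hasLeftDerivAt_tau hτ hx).comp hf rfl

theorem HasLeftDerivAt.tau_symm (hτ : IsCanonicalChart τ) {g : X → G} {x : X} {A : F →L[ℝ] E}
    (hg : HasLeftDerivAt I g x A) (hx : g x ∈ τ.target) :
    HasModelDerivAt I 𝓘(ℝ, E) (fun y => τ.symm (g y)) x
      ((dtauInv τ (-τ.symm (g x))).comp A) := by
  have h := HasModelDerivAt.comp (hasModelDerivAt_symm_mul hτ (τ.map_target hx)) hg (by simp)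
  simpa [τ.right_inv hx] using h

/-- The adjoint map produced by the moving left end is absorbed by `dtauInv_neg_comp_Ad`. This is
the origin of the opposite signs in `dtauInv` at the two ends of a step. -/
theorem HasLeftDerivAt.tau_symm_inv_mul (hτ : IsCanonicalChart τ) {g k : X → G} {x : X}
    {A B : F →L[ℝ] E} (hg : HasLeftDerivAt I g x A) (hk : HasLeftDerivAt I k x B)
    (hx : (g x)⁻¹ * k x ∈ τ.target) :
    HasModelDerivAt I 𝓘(ℝ, E) (fun y => τ.symm ((g y)⁻¹ * k y)) x
      ((dtauInv τ (-τ.symm ((g x)⁻¹ * k x))).comp B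
        - (dtauInv τ (τ.symm ((g x)⁻¹ * k x))).comp A) := by
  have h := HasLeftDerivAt.tau_symm hτ (hg.inv_mul hk) hx
  rw [ContinuousLinearMap.comp_sub, ← ContinuousLinearMap.comp_assoc] at h
  have e := dtauInv_neg_comp_Ad hτ (τ.map_target hx)
  rw [τ.right_inv hx] at e
  rwa [e] at h

/-! ### The Lagrangian along a curve of configurations -/

/-- Left translation moves the base point to `(1, ζ x)`, where the total derivative splits into its
two partial derivatives, `gdG` and `dXi`. -/
theorem HasLeftDerivAt.lagrangian {ℓ : G × E → ℝ}
    (hℓ : ContMDiff (𝓘(ℝ, E).prod 𝓘(ℝ, E)) 𝓘(ℝ, ℝ) ∞ ℓ) {g : X → G} {ζ : X → E} {x : X}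
    {A Z : F →L[ℝ] E} (hg : HasLeftDerivAt I g x A) (hζ : HasModelDerivAt I 𝓘(ℝ, E) ζ x Z) :
    HasModelDerivAt I 𝓘(ℝ, ℝ) (fun y => ℓ (g y, ζ y)) x
      ((gdG ℓ (g x) (ζ x)).comp A + (dXi ℓ (g x) (ζ x)).comp Z) := by
  have hL : ContMDiff (𝓘(ℝ, E).prod 𝓘(ℝ, E)) 𝓘(ℝ, ℝ) ∞
      (fun p : G × E => ℓ (g x * p.1, p.2)) :=
    hℓ.comp ((contMDiff_const.mul contMDiff_fst).prodMk contMDiff_snd)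
  have hd : MDifferentiableAt (𝓘(ℝ, E).prod 𝓘(ℝ, E)) 𝓘(ℝ, ℝ)
      (fun p : G × E => ℓ (g x * p.1, p.2)) (1, ζ x) := (hL _).mdifferentiableAt (by simp)
  have h := hd.hasModelDerivAt
  set B : E × E →L[ℝ] ℝ := mfderiv (𝓘(ℝ, E).prod 𝓘(ℝ, E)) 𝓘(ℝ, ℝ)
    (fun p : G × E => ℓ (g x * p.1, p.2)) (1, ζ x)
  have h1 := HasModelDerivAt.comp h ((hasModelDerivAt_id (I₁ := 𝓘(ℝ, E)) (1 : G)).prodMk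
    (hasModelDerivAt_const (I₂ := 𝓘(ℝ, E)) (ζ x) (1 : G))) rfl
  have h2 := HasModelDerivAt.comp h ((hasModelDerivAt_const (I₁ := 𝓘(ℝ, E)) (I₂ := 𝓘(ℝ, E))
    (1 : G) (ζ x)).prodMk (hasModelDerivAt_id (I₁ := 𝓘(ℝ, E)) (ζ x))) rfl
  have e1 : gdG ℓ (g x) (ζ x) = B.comp ((ContinuousLinearMap.id ℝ E).prod 0) := h1.mfderiv_eq
  have e2 : dXi ℓ (g x) (ζ x) = B.comp ((0 : E →L[ℝ] E).prod (ContinuousLinearMap.id ℝ E)) := by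
    simp only [mul_one] at h2
    exact (hasModelDerivAt_iff_hasFDerivAt.1 h2).fderiv
  have h3 := HasModelDerivAt.comp h (HasModelDerivAt.prodMk hg hζ) (by simp)
  have e3 : (gdG ℓ (g x) (ζ x)).comp A + (dXi ℓ (g x) (ζ x)).comp Z = B.comp (A.prod Z) := by
    rw [e1, e2]
    ext v
    simp [← map_add]
  rw [e3]
  refine h3.congr (Eventually.of_forall fun y => ?_)
  simp

end Chart

/-! ### Linear algebra of the discrete variational principle -/

section LinearAlgebra

variable {E : Type*} [NormedAddCommGroup E] [NormedSpace ℝ E]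

theorem dual_apply (A : E →L[ℝ] E) (μ : E →L[ℝ] ℝ) (v : E) : dual A μ v = μ (A v) := rfl

theorem dual_dual_of_comp_eq_id {A B : E →L[ℝ] E} (h : A.comp B = ContinuousLinearMap.id ℝ E)
    (μ : E →L[ℝ] ℝ) : dual B (dual A μ) = μ := by
  rw [dual, dual, ContinuousLinearMap.comp_assoc, h, ContinuousLinearMap.comp_id]

theorem dual_injective_of_comp_eq_id {A B : E →L[ℝ] E}
    (h : A.comp B = ContinuousLinearMap.id ℝ E) : Function.Injective (dual A) :=
  Function.LeftInverse.injective (g := dual B) (dual_dual_of_comp_eq_id h)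

theorem sum_single_castSucc {V : Type*} [Zero V] {N : ℕ} (T : Fin N → V → ℝ)
    (hT : ∀ k, T k 0 = 0) (k₀ : Fin N) (v : V) :
    ∑ k, T k ((Pi.single k₀.castSucc v : Fin (N + 1) → V) k.castSucc) = T k₀ v := by
  rw [Finset.sum_eq_single k₀]
  · simp
  · intro k _ hk
    rw [Pi.single_eq_of_ne (by simpa using hk), hT]
  · simp

theorem sum_single_succ {V : Type*} [Zero V] {N : ℕ} (T : Fin N → V → ℝ)
    (hT : ∀ k, T k 0 = 0) (k₀ : Fin N) (v : V) :
    ∑ k, T k ((Pi.single k₀.succ v : Fin (N + 1) → V) k.succ) = T k₀ v := by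
  rw [Finset.sum_eq_single k₀]
  · simp
  · intro k _ hk
    rw [Pi.single_eq_of_ne (by simpa using hk), hT]
  · simp

theorem sum_stage_single {V : Type*} [Zero V] {N s : ℕ} (T : Fin N → Fin s → V → ℝ)
    (hT : ∀ k i, T k i 0 = 0) (k₀ : Fin N) (i₀ : Fin s) (v : V) :
    ∑ k, ∑ i, T k i ((Pi.single k₀.castSucc (Pi.single i₀ v) : Fin (N + 1) → Fin s → V)
      k.castSucc i) = T k₀ i₀ v := by
  refine (sum_single_castSucc (fun k (w : Fin s → V) => ∑ i, T k i (w i)) (by simp [hT]) k₀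
    (Pi.single i₀ v)).trans ?_
  rw [Finset.sum_eq_single i₀]
  · simp
  · intro i _ hi
    rw [Pi.single_eq_of_ne hi, hT]
  · simp

/-- The fundamental lemma of the discrete calculus of variations: a linear form in the variations
of a discrete curve with fixed endpoints vanishes iff its coefficients do. -/
theorem forall_variation_eq_zero_iff {n s : ℕ} {h : ℝ} (hh : h ≠ 0)
    (α β : Fin (n + 1) → E →L[ℝ] ℝ) (γ σ : Fin (n + 1) → Fin s → E →L[ℝ] ℝ)
    (e : Fin (n + 1) → Fin s → E) (e' : Fin (n + 1) → E) :
    (∀ (δg : Fin (n + 2) → E) (δΘ δΞ : Fin (n + 2) → Fin s → E)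
        (δm : Fin (n + 2) → Fin s → E →L[ℝ] ℝ) (δμ : Fin (n + 2) → E →L[ℝ] ℝ),
        δg 0 = 0 → δg (Fin.last (n + 1)) = 0 →
        ∑ k, α k (δg k.castSucc) + ∑ k, β k (δg k.succ)
          + ∑ k, ∑ i, γ k i (δΘ k.castSucc i) + ∑ k, ∑ i, σ k i (δΞ k.castSucc i)
          + ∑ k, ∑ i, h * δm k.castSucc i (e k i) + ∑ k, h * δμ k.succ (e' k) = 0) ↔
      (∀ k i, γ k i = 0) ∧ (∀ k i, σ k i = 0) ∧ (∀ k i, e k i = 0) ∧ (∀ k, e' k = 0) ∧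
        ∀ k : Fin n, α k.succ + β k.castSucc = 0 := by
  constructor
  · intro H
    refine ⟨fun k i => ?_, fun k i => ?_, fun k i => ?_, fun k => ?_, fun k => ?_⟩
    · ext v
      have := H 0 (Pi.single k.castSucc (Pi.single i v)) 0 0 0 rfl rfl
      rw [sum_stage_single (fun k i v => γ k i v) (by simp)] at this
      simpa using this
    · ext v
      have := H 0 0 (Pi.single k.castSucc (Pi.single i v)) 0 0 rfl rfl
      rw [sum_stage_single (fun k i v => σ k i v) (by simp)] at this
      simpa using this
    · refine SeparatingDual.eq_zero_of_forall_dual_eq_zero (R := ℝ) fun φ => ?_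
      have := H 0 0 0 (Pi.single k.castSucc (Pi.single i φ)) 0 rfl rfl
      rw [sum_stage_single (fun k i (φ : E →L[ℝ] ℝ) => h * φ (e k i)) (by simp)] at this
      simpa [hh] using this
    · refine SeparatingDual.eq_zero_of_forall_dual_eq_zero (R := ℝ) fun φ => ?_
      have := H 0 0 0 0 (Pi.single k.succ φ) rfl rfl
      rw [sum_single_succ (fun k (φ : E →L[ℝ] ℝ) => h * φ (e' k)) (by simp)] at this
      simpa [hh] using this
    · ext v
      -- An interior node is the start of step `k + 1` and the end of step `k`, so it collects one
      -- `α` and one `β`.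
      have := H (Pi.single k.succ.castSucc v) 0 0 0 0
        (Pi.single_eq_of_ne (by simp [Fin.ext_iff]) _)
        (Pi.single_eq_of_ne (by have := k.2; simp [Fin.ext_iff]; omega) _)
      rw [sum_single_castSucc (fun k v => α k v) (by simp), ← Fin.succ_castSucc,
        sum_single_succ (fun k v => β k v) (by simp)] at this
      simpa using this
  · rintro ⟨h1, h2, h3, h4, h5⟩ δg δΘ δΞ δm δμ h0 hN
    -- The two sums lose the terms at the fixed endpoints, and what remains pairs up node by node.
    have h6 : ∑ k, α k (δg k.castSucc) + ∑ k, β k (δg k.succ) = 0 := by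
      rw [Fin.sum_univ_succ, Fin.sum_univ_castSucc (fun k => β k (δg k.succ))]
      simp only [Fin.castSucc_zero, h0, map_zero, zero_add, Fin.succ_last, hN, add_zero]
      rw [← Finset.sum_add_distrib]
      refine Finset.sum_eq_zero fun k _ => ?_
      rw [Fin.succ_castSucc]
      exact congrArg (fun φ : E →L[ℝ] ℝ => φ (δg k.succ.castSucc)) (h5 k)
    simp [h6, h1, h2, h3, h4]

/-- Under the external momentum equation, the equation for the stage momentum can be solved. -/
theorem stageMomentum_iff {s : ℕ} {a : Fin s → Fin s → ℝ} {b : Fin s → ℝ} {h : ℝ}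
    {D D' : E →L[ℝ] E} (hD : D.comp D' = ContinuousLinearMap.id ℝ E)
    {f P : Fin s → E →L[ℝ] ℝ} {p μ : E →L[ℝ] ℝ}
    (hext : dual D μ = p + h • ∑ j, b j • P j) (i : Fin s) (hb : b i ≠ 0) (M : E →L[ℝ] ℝ) :
    dual D M = p + h • ∑ j, (b j • P j - (b j * a j i / b i) • dual D (f j)) ↔
      b i • M = b i • μ - h • ∑ j, (b j * a j i) • f j := by
  -- Substituting `hext` exhibits the right-hand side as an image under `dual D`, which is injective
  -- and can be cancelled.
  have e1 : p + h • ∑ j, (b j • P j - (b j * a j i / b i) • dual D (f j))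
      = dual D (μ - h • ∑ j, (b j * a j i / b i) • f j) := by
    rw [Finset.sum_sub_distrib, smul_sub, ← add_sub_assoc, ← hext]
    ext v
    simp [dual_apply]
  have e2 : b i • μ - h • ∑ j, (b j * a j i) • f j
      = b i • (μ - h • ∑ j, (b j * a j i / b i) • f j) := by
    rw [smul_sub, smul_comm (b i) h, Finset.smul_sum (r := b i)]
    congr 3
    ext1 j
    rw [smul_smul, mul_div_cancel₀ _ hb]
  rw [e1, e2, (dual_injective_of_comp_eq_id hD).eq_iff, (smul_right_injective _ hb).eq_iff]

/-- The boundary terms of the action sum of one step along solutions of the scheme. -/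
theorem sum_stage_variation {s : ℕ} {a : Fin s → Fin s → ℝ} {b : Fin s → ℝ} {h : ℝ}
    {f P M : Fin s → E →L[ℝ] ℝ} {p μ D : E →L[ℝ] ℝ} {δΘ δΞ : Fin s → E} {η w : E}
    (hext : D = p + h • ∑ j, b j • P j)
    (hM : ∀ i, b i • M i = b i • μ - h • ∑ j, (b j * a j i) • f j)
    (hΘ : ∀ i, δΘ i = ∑ j, a i j • δΞ j) (hw : h • ∑ j, b j • δΞ j = w) :
    ∑ i, h * b i * (P i η + h * f i (δΘ i) + M i (δΞ i)) = μ w + D η - p η := by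
  have hM' : ∀ i, b i * M i (δΞ i) = b i * μ (δΞ i) - h * ∑ j, b j * a j i * f j (δΞ i) := by
    intro i
    have := congrArg (fun φ : E →L[ℝ] ℝ => φ (δΞ i)) (hM i)
    simpa using this
  have e1 : D η - p η = ∑ i, h * (b i * P i η) := by
    rw [hext]; simp [Finset.mul_sum]
  have e2 : μ w = ∑ i, h * (b i * μ (δΞ i)) := by
    rw [← hw]; simp [Finset.mul_sum]
  -- Transposing the double sum turns the force work along `δΘ` into the term that cancels the `b_j
  -- a_ji` correction in the stage momenta.
  have e3 : ∑ i, h * (h * (b i * f i (δΘ i)))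
      = ∑ i, h * (h * ∑ j, b j * a j i * f j (δΞ i)) := by
    simp only [hΘ, map_sum, map_smul, smul_eq_mul, Finset.mul_sum]
    rw [Finset.sum_comm]
    refine Finset.sum_congr rfl fun i _ => Finset.sum_congr rfl fun j _ => by ring
  calc ∑ i, h * b i * (P i η + h * f i (δΘ i) + M i (δΞ i))
      = ∑ i, h * (b i * P i η) + ∑ i, h * (h * (b i * f i (δΘ i)))
        + ∑ i, h * (b i * M i (δΞ i)) := by
        rw [← Finset.sum_add_distrib, ← Finset.sum_add_distrib]
        exact Finset.sum_congr rfl fun i _ => by ring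
    _ = μ w + D η - p η := by
        rw [e3, add_assoc, ← Finset.sum_add_distrib, add_sub_assoc, e1, e2, add_comm]
        congr 1
        refine Finset.sum_congr rfl fun i _ => ?_
        rw [hM' i]; ring

end LinearAlgebra

/-! ### Differentiating the action -/

section Derivative

variable {E : Type*} [NormedAddCommGroup E] [NormedSpace ℝ E]
  {G : Type*} [TopologicalSpace G] [ChartedSpace E G] [Group G] [LieGroup 𝓘(ℝ, E) ∞ G]
  {F : Type*} [NormedAddCommGroup F] [NormedSpace ℝ F]
  {τ : OpenPartialHomeomorph E G} {ℓ : G × E → ℝ} {h : ℝ}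

/-- The left derivative of `g τ(hΘ)` is `Ad_{τ(hΘ)⁻¹} A + h dτ_{-hΘ} Θ'`. Writing the adjoint as
`dτ_{-hΘ} dτ⁻¹_{hΘ}` makes the same force `f` appear in both terms. -/
theorem hasFDerivAt_stageLagrangian (hτ : IsCanonicalChart τ)
    (hℓ : ContMDiff (𝓘(ℝ, E).prod 𝓘(ℝ, E)) 𝓘(ℝ, ℝ) ∞ ℓ)
    {g : F → G} {Θ Ξ : F → E} {x : F} {A Θ' Ξ' : F →L[ℝ] E} {f : E →L[ℝ] ℝ}
    (hg : HasLeftDerivAt 𝓘(ℝ, F) g x A) (hΘ : HasFDerivAt Θ Θ' x) (hΞ : HasFDerivAt Ξ Ξ' x)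
    (hx : h • Θ x ∈ τ.source)
    (hf : f = dual (dtau τ (-(h • Θ x))) (gdG ℓ (g x * τ (h • Θ x)) (Ξ x))) :
    HasFDerivAt (fun y => ℓ (g y * τ (h • Θ y), Ξ y))
      ((dual (dtauInv τ (h • Θ x)) f).comp A + h • f.comp Θ'
        + (dXi ℓ (g x * τ (h • Θ x)) (Ξ x)).comp Ξ') x := by
  have h1 : HasModelDerivAt 𝓘(ℝ, F) 𝓘(ℝ, E) (fun y => h • Θ y) x (h • Θ') :=
    hasModelDerivAt_iff_hasFDerivAt.2 (hΘ.const_smul h)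
  have h2 := (hg.mul (h1.tau hτ hx)).lagrangian hℓ (hasModelDerivAt_iff_hasFDerivAt.2 hΞ)
  rw [hasModelDerivAt_iff_hasFDerivAt] at h2
  refine h2.congr_fderiv ?_
  rw [← dtau_neg_comp_dtauInv hτ hx, hf]
  ext v
  simp [dual_apply]

theorem hasFDerivAt_chart_inv_mul (hτ : IsCanonicalChart τ) {g k : F → G} {x : F}
    {A B : F →L[ℝ] E} (hg : HasLeftDerivAt 𝓘(ℝ, F) g x A) (hk : HasLeftDerivAt 𝓘(ℝ, F) k x B)
    (hx : (g x)⁻¹ * k x ∈ τ.target) :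
    HasFDerivAt (fun y => τ.symm ((g y)⁻¹ * k y))
      ((dtauInv τ (-τ.symm ((g x)⁻¹ * k x))).comp B
        - (dtauInv τ (τ.symm ((g x)⁻¹ * k x))).comp A) x :=
  hasModelDerivAt_iff_hasFDerivAt.1 (HasLeftDerivAt.tau_symm_inv_mul hτ hg hk hx)

end Derivative

namespace DiscreteCurve

/-! ### The first variation of the action sum -/

section Coefficients

variable {E : Type*} [NormedAddCommGroup E] [NormedSpace ℝ E]
  {G : Type*} [TopologicalSpace G] [ChartedSpace E G] [Group G] {N s : ℕ}

/-- The coordinate increment `τ⁻¹(g_k⁻¹ g_{k+1})`. -/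
def increment (τ : OpenPartialHomeomorph E G) (c : DiscreteCurve E G N s) (k : Fin N) : E :=
  τ.symm ((c.g k.castSucc)⁻¹ * c.g k.succ)

/-- The defect of the `i`-th internal stage equation. -/
def stageDefect (τ : OpenPartialHomeomorph E G) (a : Fin s → Fin s → ℝ) (h : ℝ)
    (c : DiscreteCurve E G N s) (k : Fin N) (i : Fin s) : E :=
  h⁻¹ • τ.symm ((c.g k.castSucc)⁻¹ * c.stageG τ h k i) - ∑ j, a i j • c.Xi k.castSucc j

/-- The defect of the external stage equation. -/
def stepDefect (τ : OpenPartialHomeomorph E G) (b : Fin s → ℝ) (h : ℝ)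
    (c : DiscreteCurve E G N s) (k : Fin N) : E :=
  h⁻¹ • τ.symm ((c.g k.castSucc)⁻¹ * c.g k.succ) - ∑ j, b j • c.Xi k.castSucc j

/-- The left-trivialized force acting during the `k`-th step. -/
def stepForce (τ : OpenPartialHomeomorph E G) (b : Fin s → ℝ) (h : ℝ)
    (ℓ : G × E → ℝ) (c : DiscreteCurve E G N s) (k : Fin N) : E →L[ℝ] ℝ :=
  h • ∑ j, b j • dual (dtauInv τ (h • c.Theta k.castSucc j)) (c.force τ h ℓ k j)

/-- The coefficient of `δg_k` in the variation of the `k`-th step. -/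
def coeffStart (τ : OpenPartialHomeomorph E G) (b : Fin s → ℝ) (h : ℝ)
    (ℓ : G × E → ℝ) (c : DiscreteCurve E G N s) (k : Fin N) : E →L[ℝ] ℝ :=
  c.stepForce τ b h ℓ k - dual (dtauInv τ (c.increment τ k)) (c.mu k.succ)

/-- The coefficient of `δg_{k+1}` in the variation of the `k`-th step. -/
def coeffEnd (τ : OpenPartialHomeomorph E G) (c : DiscreteCurve E G N s) (k : Fin N) :
    E →L[ℝ] ℝ :=
  dual (dtauInv τ (-c.increment τ k)) (c.mu k.succ)

/-- The coefficient of `δΘ_k^i`. -/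
def coeffTheta (τ : OpenPartialHomeomorph E G) (b : Fin s → ℝ) (h : ℝ)
    (ℓ : G × E → ℝ) (c : DiscreteCurve E G N s) (k : Fin N) (i : Fin s) : E →L[ℝ] ℝ :=
  h • (c.muStage k.castSucc i + (h * b i) • c.force τ h ℓ k i)

/-- The coefficient of `δΞ_k^i`. -/
def coeffXi (τ : OpenPartialHomeomorph E G) (a : Fin s → Fin s → ℝ) (b : Fin s → ℝ) (h : ℝ)
    (ℓ : G × E → ℝ) (c : DiscreteCurve E G N s) (k : Fin N) (i : Fin s) : E →L[ℝ] ℝ :=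
  h • (b i • dXi ℓ (c.stageG τ h k i) (c.Xi k.castSucc i)
    - ∑ j, a j i • c.muStage k.castSucc j - b i • c.mu k.succ)

/-- The differential of the action sum at `c` applied to a variation. -/
def firstVariation (τ : OpenPartialHomeomorph E G) (a : Fin s → Fin s → ℝ) (b : Fin s → ℝ)
    (h : ℝ) (ℓ : G × E → ℝ) (c : DiscreteCurve E G N s) (δg : Fin (N + 1) → E)
    (δΘ δΞ : Fin (N + 1) → Fin s → E) (δm : Fin (N + 1) → Fin s → E →L[ℝ] ℝ)
    (δμ : Fin (N + 1) → E →L[ℝ] ℝ) : ℝ :=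
  ∑ k, c.coeffStart τ b h ℓ k (δg k.castSucc) + ∑ k, c.coeffEnd τ k (δg k.succ)
    + ∑ k, ∑ i, c.coeffTheta τ b h ℓ k i (δΘ k.castSucc i)
    + ∑ k, ∑ i, c.coeffXi τ a b h ℓ k i (δΞ k.castSucc i)
    + ∑ k, ∑ i, h * δm k.castSucc i (c.stageDefect τ a h k i)
    + ∑ k : Fin N, h * δμ k.succ (c.stepDefect τ b h k)

end Coefficients

section

variable {E : Type*} [NormedAddCommGroup E] [NormedSpace ℝ E]
  {G : Type*} [TopologicalSpace G] [Group G] {N s : ℕ}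

theorem sum_coeffXi (τ : OpenPartialHomeomorph E G) (a : Fin s → Fin s → ℝ) (b : Fin s → ℝ)
    (h : ℝ) (ℓ : G × E → ℝ) (c : DiscreteCurve E G N s) (k : Fin N) (δΞ : Fin s → E) :
    ∑ i, c.coeffXi τ a b h ℓ k i (δΞ i)
      = ∑ i, h * (b i * dXi ℓ (c.stageG τ h k i) (c.Xi k.castSucc i) (δΞ i)
          - c.muStage k.castSucc i (∑ j, a i j • δΞ j)) - h * c.mu k.succ (∑ j, b j • δΞ j) := by
  have e : ∑ i, h * c.muStage k.castSucc i (∑ j, a i j • δΞ j)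
      = ∑ i, h * ∑ j, a j i * c.muStage k.castSucc j (δΞ i) := by
    simp only [map_sum, map_smul, smul_eq_mul, Finset.mul_sum]
    rw [Finset.sum_comm]
  simp only [mul_sub, Finset.sum_sub_distrib, e]
  simp [coeffXi, Finset.mul_sum, mul_sub, Finset.sum_sub_distrib]

theorem symm_inv_mul_stageG {τ : OpenPartialHomeomorph E G} {h : ℝ}
    {c : DiscreteCurve E G N s} {k : Fin N} {i : Fin s}
    (hc : h • c.Theta k.castSucc i ∈ τ.source) :
    τ.symm ((c.g k.castSucc)⁻¹ * c.stageG τ h k i) = h • c.Theta k.castSucc i := by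
  rw [stageG, inv_mul_cancel_left, τ.left_inv hc]

end

variable {E : Type*} [NormedAddCommGroup E] [NormedSpace ℝ E]
  {G : Type*} [TopologicalSpace G] [ChartedSpace E G] [Group G] [LieGroup 𝓘(ℝ, E) ∞ G]
  {N s : ℕ} {τ : OpenPartialHomeomorph E G} {a : Fin s → Fin s → ℝ} {b : Fin s → ℝ} {h : ℝ}
  {ℓ : G × E → ℝ}

/-- Since `g_k⁻¹ G_k^i = τ(hΘ_k^i)`, the internal constraints do not see `δg`. It enters only
through the Lagrangian and the external increment, and the latter supplies the two boundary momenta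
of a step. -/
theorem hasDerivAt_actionSum (hτ : IsCanonicalChart τ)
    (hℓ : ContMDiff (𝓘(ℝ, E).prod 𝓘(ℝ, E)) 𝓘(ℝ, ℝ) ∞ ℓ) (hh : h ≠ 0)
    {c : ℝ → DiscreteCurve E G N s} (hc : (c 0).InChart τ h)
    {A : Fin (N + 1) → ℝ →L[ℝ] E} {δΘ δΞ : Fin (N + 1) → Fin s → E}
    {δm : Fin (N + 1) → Fin s → E →L[ℝ] ℝ} {δμ : Fin (N + 1) → E →L[ℝ] ℝ}
    (hA : ∀ k, HasLeftDerivAt 𝓘(ℝ, ℝ) (fun ε => (c ε).g k) 0 (A k))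
    (hΘ : ∀ k i, HasDerivAt (fun ε => (c ε).Theta k i) (δΘ k i) 0)
    (hΞ : ∀ k i, HasDerivAt (fun ε => (c ε).Xi k i) (δΞ k i) 0)
    (hm : ∀ k i, HasDerivAt (fun ε => (c ε).muStage k i) (δm k i) 0)
    (hμ : ∀ k, HasDerivAt (fun ε => (c ε).mu k) (δμ k) 0) :
    HasDerivAt (fun ε => actionSum τ a b h ℓ (c ε))
      (firstVariation τ a b h ℓ (c 0) (fun k => A k 1) δΘ δΞ δm δμ) 0 := by
  have hL : ∀ k i, HasDerivAt (fun ε => ℓ ((c ε).stageG τ h k i, (c ε).Xi k.castSucc i))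
      (dual (dtauInv τ (h • (c 0).Theta k.castSucc i)) ((c 0).force τ h ℓ k i) (A k.castSucc 1)
        + h * (c 0).force τ h ℓ k i (δΘ k.castSucc i)
        + dXi ℓ ((c 0).stageG τ h k i) ((c 0).Xi k.castSucc i) (δΞ k.castSucc i)) 0 := by
    intro k i
    have := (hasFDerivAt_stageLagrangian hτ hℓ (hA k.castSucc) (hΘ k.castSucc i).hasFDerivAt
      (hΞ k.castSucc i).hasFDerivAt ((hc k).2 i) rfl).hasDerivAt
    refine this.congr_deriv ?_
    simp [force, stageG]
  have hS : ∀ k i, HasDerivAt (fun ε => τ.symm (((c ε).g k.castSucc)⁻¹ * (c ε).stageG τ h k i))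
      (h • δΘ k.castSucc i) 0 := by
    intro k i
    have h1 := (hΘ k.castSucc i).const_smul h
    -- For small `ε` the point `hΘ` stays in the domain of `τ`, so the stage increment is exactly
    -- `hΘ`.
    refine h1.congr_of_eventuallyEq ?_
    filter_upwards [h1.continuousAt.eventually_mem (τ.open_source.mem_nhds ((hc k).2 i))]
      with ε hε
    exact symm_inv_mul_stageG hε
  have hT : ∀ k : Fin N, HasDerivAt (fun ε => τ.symm (((c ε).g k.castSucc)⁻¹ * (c ε).g k.succ))
      (dtauInv τ (-(c 0).increment τ k) (A k.succ 1)
        - dtauInv τ ((c 0).increment τ k) (A k.castSucc 1)) 0 := by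
    intro k
    exact (hasFDerivAt_chart_inv_mul hτ (hA k.castSucc) (hA k.succ) (hc k).1).hasDerivAt
  have hΞs : ∀ (w : Fin s → ℝ) (k : Fin N),
      HasDerivAt (fun ε => ∑ j, w j • (c ε).Xi k.castSucc j)
        (∑ j, w j • δΞ k.castSucc j) 0 := fun w k =>
    HasDerivAt.fun_sum fun j _ => (hΞ k.castSucc j).const_smul (w j)
  have hsum := HasDerivAt.fun_sum (u := Finset.univ) fun (k : Fin N) _ =>
    (HasDerivAt.fun_sum (u := Finset.univ) fun (i : Fin s) _ =>
      (((hL k i).const_mul (b i)).add ((hm k.castSucc i).clm_apply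
        (((hS k i).const_smul h⁻¹).sub (hΞs (a i) k)))).const_mul h).add
      (((hμ k.succ).clm_apply (((hT k).const_smul h⁻¹).sub (hΞs b k))).const_mul h)
  refine hsum.congr_deriv ?_
  clear hsum hT hS hL hΞs
  set c0 := c 0
  rw [firstVariation]
  simp only [← Finset.sum_add_distrib]
  refine Finset.sum_congr rfl fun k _ => ?_
  rw [sum_coeffXi]
  have e1 : c0.coeffStart τ b h ℓ k (A k.castSucc 1)
      = ∑ i, h * (b i * dual (dtauInv τ (h • c0.Theta k.castSucc i)) (c0.force τ h ℓ k i)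
          (A k.castSucc 1))
        - c0.mu k.succ (dtauInv τ (c0.increment τ k) (A k.castSucc 1)) := by
    simp [coeffStart, stepForce, dual_apply, Finset.mul_sum]
  have e2 : ∑ i, c0.coeffTheta τ b h ℓ k i (δΘ k.castSucc i)
      = ∑ i, h * (c0.muStage k.castSucc i (δΘ k.castSucc i)
          + h * b i * c0.force τ h ℓ k i (δΘ k.castSucc i)) := by
    refine Finset.sum_congr rfl fun i _ => ?_
    simp only [coeffTheta, smul_apply, add_apply,
      smul_eq_mul]
  have e3 : h * c0.mu k.succ (h⁻¹ • (dtauInv τ (-c0.increment τ k) (A k.succ 1)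
        - dtauInv τ (c0.increment τ k) (A k.castSucc 1)) - ∑ j, b j • δΞ k.castSucc j)
      = c0.mu k.succ (dtauInv τ (-c0.increment τ k) (A k.succ 1))
        - c0.mu k.succ (dtauInv τ (c0.increment τ k) (A k.castSucc 1))
        - h * c0.mu k.succ (∑ j, b j • δΞ k.castSucc j) := by
    rw [map_sub, map_smul, map_sub, smul_eq_mul, mul_sub, mul_inv_cancel_left₀ hh]
  have e4 : ∀ i, h⁻¹ • h • δΘ k.castSucc i = δΘ k.castSucc i := fun i =>
    inv_smul_smul₀ hh _
  have e5 : c0.coeffEnd τ k (A k.succ 1)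
      = c0.mu k.succ (dtauInv τ (-c0.increment τ k) (A k.succ 1)) := rfl
  rw [e1, e2, e5, mul_add, e3]
  change ∑ i, h * (b i * _ + (δm k.castSucc i (c0.stageDefect τ a h k i) + _))
    + (h * δμ k.succ (c0.stepDefect τ b h k) + _) = _
  simp only [e4]
  have e6 : ∀ i, h * (b i * (dual (dtauInv τ (h • c0.Theta k.castSucc i)) (c0.force τ h ℓ k i)
            (A k.castSucc 1) + h * c0.force τ h ℓ k i (δΘ k.castSucc i)
            + dXi ℓ (c0.stageG τ h k i) (c0.Xi k.castSucc i) (δΞ k.castSucc i))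
          + (δm k.castSucc i (c0.stageDefect τ a h k i)
            + c0.muStage k.castSucc i (δΘ k.castSucc i - ∑ j, a i j • δΞ k.castSucc j)))
      = h * (b i * dual (dtauInv τ (h • c0.Theta k.castSucc i)) (c0.force τ h ℓ k i)
          (A k.castSucc 1))
        + h * (c0.muStage k.castSucc i (δΘ k.castSucc i)
          + h * b i * c0.force τ h ℓ k i (δΘ k.castSucc i))
        + h * (b i * dXi ℓ (c0.stageG τ h k i) (c0.Xi k.castSucc i) (δΞ k.castSucc i)
          - c0.muStage k.castSucc i (∑ j, a i j • δΞ k.castSucc j))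
        + h * δm k.castSucc i (c0.stageDefect τ a h k i) := by
    intro i
    rw [map_sub]
    ring
  rw [Finset.sum_congr rfl fun i _ => e6 i]
  simp only [Finset.sum_add_distrib]
  ring

end DiscreteCurve

/-! ### Realizing variations by curves, and criticality as vanishing of the first variation. -/

namespace DiscreteCurve

variable {E : Type*} [NormedAddCommGroup E] [NormedSpace ℝ E]
  {G : Type*} [TopologicalSpace G] [ChartedSpace E G] [Group G]
  {N s : ℕ} {τ : OpenPartialHomeomorph E G} {a : Fin s → Fin s → ℝ} {b : Fin s → ℝ} {h : ℝ}
  {ℓ : G × E → ℝ}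

/-- The variation of a discrete curve with prescribed velocities. -/
def vary (τ : OpenPartialHomeomorph E G) (c : DiscreteCurve E G N s) (w : Fin (N + 1) → E)
    (δΘ δΞ : Fin (N + 1) → Fin s → E) (δm : Fin (N + 1) → Fin s → E →L[ℝ] ℝ)
    (δμ : Fin (N + 1) → E →L[ℝ] ℝ) (ε : ℝ) : DiscreteCurve E G N s where
  g k := c.g k * τ (ε • w k)
  mu k := c.mu k + ε • δμ k
  Theta k i := c.Theta k i + ε • δΘ k i
  Xi k i := c.Xi k i + ε • δΞ k i
  muStage k i := c.muStage k i + ε • δm k i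

theorem vary_zero (hτ : IsCanonicalChart τ) (c : DiscreteCurve E G N s) (w : Fin (N + 1) → E)
    (δΘ δΞ : Fin (N + 1) → Fin s → E) (δm : Fin (N + 1) → Fin s → E →L[ℝ] ℝ)
    (δμ : Fin (N + 1) → E →L[ℝ] ℝ) : c.vary τ w δΘ δΞ δm δμ 0 = c := by
  ext <;> simp [vary, hτ.map_zero]

theorem contDiff_add_smul {V : Type*} [NormedAddCommGroup V] [NormedSpace ℝ V] (x v : V) :
    ContDiff ℝ ∞ (fun ε : ℝ => x + ε • v) :=
  contDiff_const.add (contDiff_id.smul contDiff_const)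

theorem hasDerivAt_add_smul {V : Type*} [NormedAddCommGroup V] [NormedSpace ℝ V] (x v : V)
    (t : ℝ) : HasDerivAt (fun ε : ℝ => x + ε • v) v t := by
  simpa using ((hasDerivAt_id t).smul_const v).const_add x

variable [LieGroup 𝓘(ℝ, E) ∞ G]

/-- For large `ε` the point `ε w_k` may leave the domain of `τ`. This is harmless: smoothness is
required only at `ε = 0`, and the endpoints stay fixed for all `ε` because `w` vanishes there. -/
theorem isVariation_vary (hτ : IsCanonicalChart τ) {g₁ g₂ : G} {c : DiscreteCurve E G N s}
    (hc : c ∈ pathSpace E N s g₁ g₂) {w : Fin (N + 1) → E} (h0 : w 0 = 0)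
    (hN : w (Fin.last N) = 0) (δΘ δΞ : Fin (N + 1) → Fin s → E)
    (δm : Fin (N + 1) → Fin s → E →L[ℝ] ℝ) (δμ : Fin (N + 1) → E →L[ℝ] ℝ) :
    IsVariation g₁ g₂ c (c.vary τ w δΘ δΞ δm δμ) where
  at_zero := vary_zero hτ c w δΘ δΞ δm δμ
  mem ε := by
    refine ⟨?_, ?_⟩
    · simpa [vary, h0, hτ.map_zero] using hc.1
    · simpa [vary, hN, hτ.map_zero] using hc.2
  smooth_g k := by
    have h1 : ContMDiffAt 𝓘(ℝ, E) 𝓘(ℝ, E) ∞ τ ((0 : ℝ) • w k) := by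
      rw [zero_smul]
      exact hτ.smooth.contMDiffAt (τ.open_source.mem_nhds hτ.zero_mem)
    have h2 : ContMDiffAt 𝓘(ℝ, ℝ) 𝓘(ℝ, E) ∞ (fun ε : ℝ => ε • w k) 0 :=
      (contDiff_id.smul contDiff_const : ContDiff ℝ ∞ fun ε : ℝ => ε • w k).contMDiff 0
    exact contMDiffAt_const.mul (h1.comp 0 h2)
  smooth_mu k := (contDiff_add_smul _ _).contDiffAt
  smooth_Theta k i := (contDiff_add_smul _ _).contDiffAt
  smooth_Xi k i := (contDiff_add_smul _ _).contDiffAt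
  smooth_muStage k i := (contDiff_add_smul _ _).contDiffAt

theorem hasLeftDerivAt_vary (hτ : IsCanonicalChart τ) (x : G) (w : E) :
    HasLeftDerivAt 𝓘(ℝ, ℝ) (fun ε : ℝ => x * τ (ε • w)) 0
      (ContinuousLinearMap.toSpanSingleton ℝ (dtau τ 0 w)) := by
  have h1 : HasModelDerivAt 𝓘(ℝ, ℝ) 𝓘(ℝ, E) (fun ε : ℝ => ε • w) 0
      (ContinuousLinearMap.toSpanSingleton ℝ w) :=
    hasModelDerivAt_iff_hasFDerivAt.2 (ContinuousLinearMap.toSpanSingleton ℝ w).hasFDerivAt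
  have h2 := h1.tau hτ (by simpa using hτ.zero_mem)
  have e : ContinuousLinearMap.toSpanSingleton ℝ (dtau τ 0 w)
      = (dtau τ (-((0 : ℝ) • w))).comp (ContinuousLinearMap.toSpanSingleton ℝ w) := by
    ext; simp
  rw [e]
  refine HasModelDerivAt.congr h2 (Eventually.of_forall fun ε => ?_)
  simp [mul_assoc]

theorem isCritical_iff_firstVariation (hτ : IsCanonicalChart τ)
    (hℓ : ContMDiff (𝓘(ℝ, E).prod 𝓘(ℝ, E)) 𝓘(ℝ, ℝ) ∞ ℓ) (hh : h ≠ 0) {g₁ g₂ : G}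
    {c : DiscreteCurve E G N s} (hc : c ∈ pathSpace E N s g₁ g₂) (hch : c.InChart τ h) :
    c.IsCritical τ a b h ℓ g₁ g₂ ↔
      ∀ (δg : Fin (N + 1) → E) (δΘ δΞ : Fin (N + 1) → Fin s → E)
        (δm : Fin (N + 1) → Fin s → E →L[ℝ] ℝ) (δμ : Fin (N + 1) → E →L[ℝ] ℝ),
        δg 0 = 0 → δg (Fin.last N) = 0 → c.firstVariation τ a b h ℓ δg δΘ δΞ δm δμ = 0 := by
  constructor
  · intro H δg δΘ δΞ δm δμ h0 hN
    have hinv : (dtau τ 0).comp (dtauInv τ 0) = ContinuousLinearMap.id ℝ E :=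
      dtau_comp_dtauInv hτ hτ.zero_mem
    -- The derivative of `τ` at `0` is invertible but need not be the identity, so the prescribed
    -- velocity is corrected by its inverse.
    set w : Fin (N + 1) → E := fun k => dtauInv τ 0 (δg k)
    have hw : ∀ k, dtau τ 0 (w k) = δg k := fun k =>
      congrArg (fun φ : E →L[ℝ] E => φ (δg k)) hinv
    have hvar := isVariation_vary hτ hc (w := w) (by simp [w, h0]) (by simp [w, hN]) δΘ δΞ δm δμ
    have hz := vary_zero hτ c w δΘ δΞ δm δμ
    have hd := hasDerivAt_actionSum (a := a) (b := b) hτ hℓ hh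
      (c := c.vary τ w δΘ δΞ δm δμ) (by rw [hz]; exact hch)
      (fun k => hasLeftDerivAt_vary hτ (c.g k) (w k))
      (fun k i => hasDerivAt_add_smul (c.Theta k i) (δΘ k i) 0)
      (fun k i => hasDerivAt_add_smul (c.Xi k i) (δΞ k i) 0)
      (fun k i => hasDerivAt_add_smul (c.muStage k i) (δm k i) 0)
      (fun k => hasDerivAt_add_smul (c.mu k) (δμ k) 0)
    have := hd.unique (H _ hvar)
    simpa [hz, hw] using this
  · intro H cv hcv
    have hA : ∀ k, HasLeftDerivAt 𝓘(ℝ, ℝ) (fun ε => (cv ε).g k) 0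
        (leftDeriv (E := E) 𝓘(ℝ, ℝ) (fun ε => (cv ε).g k) 0) := fun k =>
      ((hcv.smooth_g k).mdifferentiableAt (by simp)).hasLeftDerivAt
    have hconst : ∀ (k : Fin (N + 1)) (x : G), (∀ ε, (cv ε).g k = x) →
        leftDeriv (E := E) 𝓘(ℝ, ℝ) (fun ε => (cv ε).g k) 0 = 0 := by
      intro k x hx
      rw [funext hx]
      exact leftDeriv_const x 0
    have hd := hasDerivAt_actionSum (a := a) (b := b) hτ hℓ hh (c := cv)
      (by rw [hcv.at_zero]; exact hch) hA
      (fun k i => ((hcv.smooth_Theta k i).differentiableAt (by simp)).hasDerivAt)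
      (fun k i => ((hcv.smooth_Xi k i).differentiableAt (by simp)).hasDerivAt)
      (fun k i => ((hcv.smooth_muStage k i).differentiableAt (by simp)).hasDerivAt)
      (fun k => ((hcv.smooth_mu k).differentiableAt (by simp)).hasDerivAt)
    refine hd.congr_deriv ?_
    rw [hcv.at_zero]
    refine H _ _ _ _ _ ?_ ?_
    · rw [hconst 0 g₁ fun ε => (hcv.mem ε).1]; rfl
    · rw [hconst (Fin.last N) g₂ fun ε => (hcv.mem ε).2]; rfl

/-! ### The discrete Euler-Lagrange equations and the scheme -/

/-- The discrete Euler-Lagrange equations, one for each independent variation. -/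
theorem isCritical_iff_coefficients {n : ℕ} (hτ : IsCanonicalChart τ)
    (hℓ : ContMDiff (𝓘(ℝ, E).prod 𝓘(ℝ, E)) 𝓘(ℝ, ℝ) ∞ ℓ) (hh : h ≠ 0) {g₁ g₂ : G}
    {c : DiscreteCurve E G (n + 1) s} (hc : c ∈ pathSpace E (n + 1) s g₁ g₂)
    (hch : c.InChart τ h) :
    c.IsCritical τ a b h ℓ g₁ g₂ ↔
      (∀ k i, c.coeffTheta τ b h ℓ k i = 0) ∧ (∀ k i, c.coeffXi τ a b h ℓ k i = 0) ∧
      (∀ k i, c.stageDefect τ a h k i = 0) ∧ (∀ k, c.stepDefect τ b h k = 0) ∧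
      ∀ k : Fin n, c.coeffStart τ b h ℓ k.succ + c.coeffEnd τ k.castSucc = 0 := by
  rw [isCritical_iff_firstVariation hτ hℓ hh hc hch]
  exact forall_variation_eq_zero_iff hh _ _ _ _ _ _

/-- The equations match coefficient by coefficient. Inserting the multiplier values from
`coeffTheta` into `coeffXi` gives the stage momentum equation in the solved form of
`stageMomentum_iff`. The interior node equations are the external momentum equations of all steps
after the initial one, whose own equation is linear and invertible in `μ_0`. -/
theorem satisfiesVPRK_and_muStage_iff {n : ℕ} (hτ : IsCanonicalChart τ) (hb : ∀ i, b i ≠ 0)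
    (hh : h ≠ 0) {c : DiscreteCurve E G (n + 1) s} (hch : c.InChart τ h) {ξ₀ : E}
    (hξ₀ : h • ξ₀ ∈ τ.source) :
    ((∃! ν : E →L[ℝ] ℝ, (c.withMuZero ν).SatisfiesVPRK τ a b h ℓ ξ₀) ∧
        ∀ (k : Fin (n + 1)) (i : Fin s),
          c.muStage k.castSucc i = -((h * b i) • c.force τ h ℓ k i)) ↔
      (∀ k i, c.coeffTheta τ b h ℓ k i = 0) ∧ (∀ k i, c.coeffXi τ a b h ℓ k i = 0) ∧
      (∀ k i, c.stageDefect τ a h k i = 0) ∧ (∀ k, c.stepDefect τ b h k = 0) ∧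
      ∀ k : Fin n, c.coeffStart τ b h ℓ k.succ + c.coeffEnd τ k.castSucc = 0 := by
  have hζ : ∀ k, c.increment τ k ∈ τ.source := fun k => τ.map_target (hch k).1
  have hmu : ∀ ν (k : Fin (n + 1)), (c.withMuZero ν).mu k.succ = c.mu k.succ := fun ν k =>
    Function.update_of_ne (Fin.succ_ne_zero k) ν c.mu
  have hmu0 : ∀ ν, (c.withMuZero ν).mu 0 = ν := fun ν => by simp [withMuZero]
  have hΘ : ∀ k i, c.coeffTheta τ b h ℓ k i = 0 ↔
      c.muStage k.castSucc i = -((h * b i) • c.force τ h ℓ k i) := by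
    intro k i
    rw [coeffTheta, smul_eq_zero_iff_right hh, add_eq_zero_iff_eq_neg]
  have hΞ : (∀ k i, c.coeffTheta τ b h ℓ k i = 0) → ∀ k i, c.coeffXi τ a b h ℓ k i = 0 ↔
      b i • dXi ℓ (c.stageG τ h k i) (c.Xi k.castSucc i)
        = b i • c.mu k.succ - h • ∑ j, (b j * a j i) • c.force τ h ℓ k j := by
    intro H k i
    have e : ∑ j, a j i • c.muStage k.castSucc j
        = -(h • ∑ j, (b j * a j i) • c.force τ h ℓ k j) := by
      rw [Finset.smul_sum, ← Finset.sum_neg_distrib]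
      refine Finset.sum_congr rfl fun j _ => ?_
      rw [(hΘ k j).1 (H k j), smul_neg, smul_smul, smul_smul]
      ring_nf
    rw [coeffXi, smul_eq_zero_iff_right hh, e, sub_neg_eq_add, sub_eq_zero, eq_sub_iff_add_eq]
  have hstep : ∀ k, c.stepDefect τ b h k = 0 ↔
      c.increment τ k = h • ∑ j, b j • c.Xi k.castSucc j := by
    intro k
    rw [stepDefect, sub_eq_zero, inv_smul_eq_iff₀ hh]
    rfl
  have hD : ∀ k, (dtauInv τ (c.increment τ k)).comp (dtau τ (c.increment τ k))
      = ContinuousLinearMap.id ℝ E := fun k => dtauInv_comp_dtau hτ (hζ k)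
  have hext : ∀ (ν : E →L[ℝ] ℝ) (ξ : Fin (n + 2) → E), ξ 0 = ξ₀ →
      (∀ k : Fin (n + 1), h • ξ k.succ = c.increment τ k) →
      ((∀ k : Fin (n + 1), dual (dtauInv τ (c.increment τ k)) (c.mu k.succ)
          = (c.withMuZero ν).momentum τ h ξ k.castSucc + c.stepForce τ b h ℓ k) ↔
        dual (dtauInv τ (-(h • ξ₀))) ν
          = dual (dtauInv τ (c.increment τ 0)) (c.mu (Fin.succ 0)) - c.stepForce τ b h ℓ 0 ∧
        ∀ k : Fin n, c.coeffStart τ b h ℓ k.succ + c.coeffEnd τ k.castSucc = 0) := by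
    intro ν ξ h0 hξ
    -- Step zero is split off: it alone involves `ν` and `ξ₀`, and it has no counterpart among the
    -- node equations.
    rw [Fin.forall_fin_succ]
    refine and_congr ?_ (forall_congr' fun k => ?_)
    · rw [Fin.castSucc_zero, momentum, hmu0, h0, eq_sub_iff_add_eq, eq_comm]
    · rw [← Fin.succ_castSucc, momentum, hmu, hξ, coeffStart, coeffEnd, sub_add_eq_add_sub,
        sub_eq_zero, add_comm (c.stepForce τ b h ℓ k.succ), eq_comm]
  have hvp : ∀ ν, (c.withMuZero ν).SatisfiesVPRK τ a b h ℓ ξ₀ ↔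
      (∀ k i, c.stageDefect τ a h k i = 0) ∧ (∀ k, c.stepDefect τ b h k = 0) ∧
      (∀ k i, b i • dXi ℓ (c.stageG τ h k i) (c.Xi k.castSucc i)
        = b i • c.mu k.succ - h • ∑ j, (b j * a j i) • c.force τ h ℓ k j) ∧
      dual (dtauInv τ (-(h • ξ₀))) ν
          = dual (dtauInv τ (c.increment τ 0)) (c.mu (Fin.succ 0)) - c.stepForce τ b h ℓ 0 ∧
        ∀ k : Fin n, c.coeffStart τ b h ℓ k.succ + c.coeffEnd τ k.castSucc = 0 := by
    intro ν
    constructor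
    · rintro ⟨ξ, M, h0, H⟩
      have h1 : ∀ k, c.stepDefect τ b h k = 0 := fun k => sub_eq_zero.2 (H.external k).1
      have h2 : ∀ k : Fin (n + 1), h • ξ k.succ = c.increment τ k := fun k => by
        rw [(hstep k).1 (h1 k), ← (H.external k).2]; rfl
      have h3 := H.externalMomentum
      simp only [hmu, h2] at h3
      have h4 := H.stageMomentum
      simp only [h2] at h4
      refine ⟨fun k i => sub_eq_zero.2 (H.internal k i).1, h1, fun k i => ?_,
        (hext ν ξ h0 h2).1 h3⟩
      have h5 := (stageMomentum_iff (hD k) (h3 k) i (hb i) _).1 (h4 k i)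
      rwa [H.legendre k i] at h5
    · rintro ⟨h1, h2, h3, h4⟩
      set ξ : Fin (n + 2) → E := Fin.cons ξ₀ fun k => ∑ j, b j • c.Xi k.castSucc j
      have h0 : ξ 0 = ξ₀ := rfl
      have h5 : ∀ k : Fin (n + 1), h • ξ k.succ = c.increment τ k := fun k =>
        ((hstep k).1 (h2 k)).symm
      have h6 := (hext ν ξ h0 h5).2 h4
      refine ⟨ξ, fun k i => dXi ℓ (c.stageG τ h k i) (c.Xi k.castSucc i), h0, ?_, ?_, ?_, ?_, ?_⟩
      · intro k i
        refine ⟨sub_eq_zero.1 (h1 k i), ?_⟩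
        have h7 := sub_eq_zero.1 (h1 k i)
        -- The equation for `Θ` comes for free, since `h⁻¹ τ⁻¹(g_k⁻¹ G_k^i)` is `Θ_k^i` by
        -- construction of the stage point.
        rw [symm_inv_mul_stageG ((hch k).2 i), inv_smul_smul₀ hh] at h7
        exact h7.symm
      · exact fun k => ⟨sub_eq_zero.1 (h2 k), rfl⟩
      · intro k i
        rw [h5]
        exact (stageMomentum_iff (hD k) (h6 k) i (hb i) _).2 (h3 k i)
      · intro k
        rw [h5, hmu]
        exact h6 k
      · exact fun k i => rfl
  have hneg := hτ.neg_mem _ hξ₀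
  constructor
  · rintro ⟨⟨ν, hν, -⟩, hm⟩
    have hm' : ∀ k i, c.coeffTheta τ b h ℓ k i = 0 := fun k i => (hΘ k i).2 (hm k i)
    obtain ⟨h1, h2, h3, -, h4⟩ := (hvp ν).1 hν
    exact ⟨hm', fun k i => (hΞ hm' k i).2 (h3 k i), h1, h2, h4⟩
  · rintro ⟨h1, h2, h3, h4, h5⟩
    -- The witness solves the balance of step zero for `μ_0`, with `dual (dtau _)` as inverse of
    -- `dual (dtauInv _)`. The other one-sided inverse gives uniqueness.
    refine ⟨⟨dual (dtau τ (-(h • ξ₀)))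
      (dual (dtauInv τ (c.increment τ 0)) (c.mu (Fin.succ 0)) - c.stepForce τ b h ℓ 0),
      ?_, ?_⟩, fun k i => (hΘ k i).1 (h1 k i)⟩
    · exact (hvp _).2 ⟨h3, h4, fun k i => (hΞ h1 k i).1 (h2 k i),
        dual_dual_of_comp_eq_id (dtau_comp_dtauInv hτ hneg) _, h5⟩
    · intro ν hν
      rw [← ((hvp ν).1 hν).2.2.2.1]
      exact (dual_dual_of_comp_eq_id (dtauInv_comp_dtau hτ hneg) _).symm

end DiscreteCurve

/-! ### Pullbacks of exterior derivatives to vector spaces -/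

section Pullback

variable {F : Type*} [NormedAddCommGroup F] [NormedSpace ℝ F]
  {H : Type*} [TopologicalSpace H] {I : ModelWithCorners ℝ F H} [I.Boundaryless]
  {M : Type*} [TopologicalSpace M] [ChartedSpace H M] [IsManifold I ∞ M]
  {X : Type*} [NormedAddCommGroup X] [NormedSpace ℝ X]

theorem contMDiffAt_extChartAt_symm_of_mem (m : M) {u : F} (hu : u ∈ (extChartAt I m).target) :
    ContMDiffAt 𝓘(ℝ, F) I ∞ (extChartAt I m).symm u :=
  (contMDiffOn_extChartAt_symm m).contMDiffAt ((isOpen_extChartAt_target (I := I) m).mem_nhds hu)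

omit [I.Boundaryless] in
theorem hasModelDerivAt_extChartAt_self (m : M) :
    HasModelDerivAt I 𝓘(ℝ, F) (extChartAt I m) m (ContinuousLinearMap.id ℝ F) := by
  have h := (mdifferentiableAt_extChartAt (I := I) (mem_chart_source H m)).hasModelDerivAt
  rw [mfderiv_extChartAt_self] at h
  exact h

/-- The exterior derivative is natural: it can be computed from the pullback of the one-form to a
vector space. -/
theorem exists_hasFDerivAt_pullback {f : X → M} {y₀ : X} {m : M} {A : X →L[ℝ] F}
    (hf : ContMDiffAt 𝓘(ℝ, X) I 2 f y₀) (hm : f y₀ = m) (hA : HasModelDerivAt 𝓘(ℝ, X) I f y₀ A)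
    {α : ∀ x : M, TangentSpace I x →L[ℝ] ℝ}
    (hα : DifferentiableAt ℝ (oneFormInChart I α m) (extChartAt I m m))
    {B : X → X →L[ℝ] ℝ}
    (hB : ∀ y (A' : X →L[ℝ] F), HasModelDerivAt 𝓘(ℝ, X) I f y A' →
      B y = (α (f y) : F →L[ℝ] ℝ).comp A') :
    ∃ B' : X →L[ℝ] X →L[ℝ] ℝ, HasFDerivAt B B' y₀ ∧
      ∀ v w : X, B' v w - B' w v = dOneForm I α m (A v : F) (A w : F) := by
  subst hm
  set ψ := extChartAt I (f y₀)
  set q : X → F := fun y => ψ (f y)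
  have hq : ContDiffAt ℝ 2 q y₀ := by
    rw [← contMDiffAt_iff_contDiffAt]
    exact (contMDiffAt_extChartAt (n := 2)).comp y₀ hf
  have hqA : fderiv ℝ q y₀ = A := by
    have := HasModelDerivAt.comp (hasModelDerivAt_extChartAt_self (I := I) (f y₀)) hA rfl
    rw [hasModelDerivAt_iff_hasFDerivAt] at this
    exact this.fderiv.trans (ContinuousLinearMap.id_comp _)
  have hsrc : ∀ᶠ y in 𝓝 y₀, f y ∈ ψ.source :=
    hf.continuousAt.eventually_mem (extChartAt_source_mem_nhds (I := I) (f y₀))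
  -- In the chart the pullback is the local form at `q y` composed with `Dq(y)`. Its derivative has
  -- one term from the derivative of the form and one from `D²q`. The latter is symmetric and drops
  -- out on antisymmetrizing.
  have hBq : ∀ᶠ y in 𝓝 y₀, B y = (oneFormInChart I α (f y₀) (q y)).comp (fderiv ℝ q y) := by
    filter_upwards [hsrc.eventually_nhds, hq.eventually (by simp)] with y hy hqy
    have h1 : HasModelDerivAt 𝓘(ℝ, X) 𝓘(ℝ, F) q y (fderiv ℝ q y) :=
      hasModelDerivAt_iff_hasFDerivAt.2 (hqy.differentiableAt (by simp)).hasFDerivAt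
    have h2 := ((contMDiffAt_extChartAt_symm_of_mem (I := I) (f y₀)
      (ψ.map_source hy.self_of_nhds)).mdifferentiableAt (by simp)).hasModelDerivAt
    have h3 := HasModelDerivAt.comp h2 h1 rfl
    have h4 : HasModelDerivAt 𝓘(ℝ, X) I f y _ := h3.congr (by
      filter_upwards [hy] with y' hy'
      exact (ψ.left_inv hy').symm)
    have e : ∀ m m' : M, m = m' → (α m : F →L[ℝ] ℝ) = α m' := by
      rintro m _ rfl; rfl
    rw [hB y _ h4]
    ext v
    exact congrArg (fun φ : F →L[ℝ] ℝ => φ _) (e _ _ (ψ.left_inv hy.self_of_nhds).symm)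
  have hq' : HasFDerivAt (fderiv ℝ q) (fderiv ℝ (fderiv ℝ q) y₀) y₀ :=
    ((hq.fderiv_right (m := 1) (by norm_num)).differentiableAt (by simp)).hasFDerivAt
  have hA' := hα.hasFDerivAt.comp y₀ (hq.differentiableAt (by simp)).hasFDerivAt
  refine ⟨_, (hA'.clm_comp hq').congr_of_eventuallyEq hBq, fun v w => ?_⟩
  have hsymm : fderiv ℝ (fderiv ℝ q) y₀ v w = fderiv ℝ (fderiv ℝ q) y₀ w v :=
    hq.isSymmSndFDerivAt (by simp) v w
  have e1 : ∀ v : F, (mfderiv I 𝓘(ℝ, F) ψ (f y₀) v : F) = v := fun v => by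
    rw [(hasModelDerivAt_extChartAt_self (I := I) (f y₀)).mfderiv_eq]; rfl
  simp only [dOneForm]
  rw [e1, e1]
  simp [hqA, hsymm]
  rfl

end Pullback

section

variable {E : Type*} [NormedAddCommGroup E] [NormedSpace ℝ E]
  {G : Type*} [TopologicalSpace G] [ChartedSpace E G] [Group G] [LieGroup 𝓘(ℝ, E) ∞ G]
  {X : Type*} [NormedAddCommGroup X] [NormedSpace ℝ X]

/-! ### The canonical symplectic form -/

theorem two_le_infty : (2 : WithTop ℕ∞) ≤ ∞ :=
  WithTop.coe_le_coe.2 (le_top : (2 : ℕ∞) ≤ ⊤)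

/-- The left derivative at `y` is the partial derivative in `y'` of `χ(g(y)⁻¹ g(y'))` on the
diagonal, with `χ` the chart at `1`, whose derivative there is the identity. One order of smoothness
is lost. -/
theorem contDiffAt_leftDeriv {g : X → G} {y₀ : X}
    (hg : ContMDiffAt 𝓘(ℝ, X) 𝓘(ℝ, E) 2 g y₀) :
    ContDiffAt ℝ 1 (leftDeriv (E := E) 𝓘(ℝ, X) g) y₀ := by
  set χ := extChartAt 𝓘(ℝ, E) (1 : G)
  have : LieGroup 𝓘(ℝ, E) 2 G := LieGroup.of_le (n := ∞) two_le_infty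
  set K : X → X → E := fun y y' => χ ((g y)⁻¹ * g y')
  have hK : ContDiffAt ℝ 2 (Function.uncurry K) (y₀, y₀) := by
    rw [← contMDiffAt_iff_contDiffAt]
    have h1 : ContMDiffAt 𝓘(ℝ, X × X) 𝓘(ℝ, E) 2 (fun p : X × X => g p.1) (y₀, y₀) :=
      ContMDiffAt.comp (y₀, y₀) hg contDiff_fst.contMDiff.contMDiffAt
    have h2 : ContMDiffAt 𝓘(ℝ, X × X) 𝓘(ℝ, E) 2 (fun p : X × X => g p.2) (y₀, y₀) :=
      ContMDiffAt.comp (y₀, y₀) hg contDiff_snd.contMDiff.contMDiffAt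
    refine ContMDiffAt.comp_of_eq (contMDiffAt_extChartAt (n := 2)) (h1.inv.mul h2) ?_
    simp
  have h3 : ContDiffAt ℝ 1 (fun y => fderiv ℝ (K y) y) y₀ :=
    ContDiffAt.fderiv (g := id) hK contDiffAt_id (by norm_num)
  refine h3.congr_of_eventuallyEq ?_
  filter_upwards [(contMDiffAt_iff_contMDiffAt_nhds (by simp)).1 hg] with y hy
  have h4 := (hy.mdifferentiableAt (by simp)).hasLeftDerivAt
  have h5 := HasModelDerivAt.comp (hasModelDerivAt_extChartAt_self (I := 𝓘(ℝ, E)) (1 : G)) h4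
    (by simp)
  rw [hasModelDerivAt_iff_hasFDerivAt, ContinuousLinearMap.id_comp] at h5
  exact h5.fderiv.symm

/-- Pulled back along `(g, μ)`, the canonical one-form is `⟨μ, g⁻¹ dg⟩`, which is the shape of the
boundary terms of the action. -/
theorem canonicalOneForm_comp {f : X → G × (E →L[ℝ] ℝ)} {y : X} {A : X →L[ℝ] E × (E →L[ℝ] ℝ)}
    (hf : HasModelDerivAt 𝓘(ℝ, X) (𝓘(ℝ, E).prod 𝓘(ℝ, E →L[ℝ] ℝ)) f y A) :
    (f y).2.comp (leftDeriv (E := E) 𝓘(ℝ, X) (fun y' => (f y').1) y)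
      = (canonicalOneForm (f y) : E × (E →L[ℝ] ℝ) →L[ℝ] ℝ).comp A := by
  have h1 := (mdifferentiableAt_fst (I := 𝓘(ℝ, E)) (I' := 𝓘(ℝ, E →L[ℝ] ℝ))
    (x := f y)).hasModelDerivAt
  have h2 := (mdifferentiableAt_mul_left (E := E) (f y).1⁻¹ (f y).1).hasModelDerivAt
  have h3 : HasLeftDerivAt 𝓘(ℝ, X) (fun y' => (f y').1) y _ :=
    HasModelDerivAt.comp h2 (HasModelDerivAt.comp h1 hf rfl) rfl
  rw [h3.leftDeriv_eq]
  ext v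
  rfl

theorem differentiableAt_canonicalOneForm (m : G × (E →L[ℝ] ℝ)) :
    DifferentiableAt ℝ
      (oneFormInChart (𝓘(ℝ, E).prod 𝓘(ℝ, E →L[ℝ] ℝ)) (canonicalOneForm (E := E) (G := G)) m)
      (extChartAt (𝓘(ℝ, E).prod 𝓘(ℝ, E →L[ℝ] ℝ)) m m) := by
  set J := 𝓘(ℝ, E).prod 𝓘(ℝ, E →L[ℝ] ℝ)
  set ψ := extChartAt J m
  have hm : ψ m ∈ ψ.target := mem_extChartAt_target m
  have h0 : ContMDiffAt 𝓘(ℝ, E × (E →L[ℝ] ℝ)) J 2 ψ.symm (ψ m) :=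
    (contMDiffAt_extChartAt_symm_of_mem m hm).of_le two_le_infty
  have h1 : ContDiffAt ℝ 1 (leftDeriv (E := E) 𝓘(ℝ, E × (E →L[ℝ] ℝ))
      (fun u => (ψ.symm u).1)) (ψ m) :=
    contDiffAt_leftDeriv h0.fst
  have h2 : ContDiffAt ℝ 2 (fun u => (ψ.symm u).2) (ψ m) := h0.snd.contDiffAt
  refine DifferentiableAt.congr_of_eventuallyEq ((h2.differentiableAt (by simp)).clm_comp
    (h1.differentiableAt (by simp))) ?_
  filter_upwards [(isOpen_extChartAt_target (I := J) m).mem_nhds hm] with u hu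
  have h3 := ((contMDiffAt_extChartAt_symm_of_mem (I := J) m hu).mdifferentiableAt
    (by simp)).hasModelDerivAt
  exact (canonicalOneForm_comp h3).symm

/-- The order of `v` and `w` in the difference accounts for the minus sign in `Ω = -dΘ`. -/
theorem exists_hasFDerivAt_canonicalTwoForm {f : X → G × (E →L[ℝ] ℝ)} {y₀ : X}
    {m : G × (E →L[ℝ] ℝ)} {A : X →L[ℝ] E × (E →L[ℝ] ℝ)}
    (hf : ContMDiffAt 𝓘(ℝ, X) (𝓘(ℝ, E).prod 𝓘(ℝ, E →L[ℝ] ℝ)) 2 f y₀) (hm : f y₀ = m)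
    (hA : HasModelDerivAt 𝓘(ℝ, X) (𝓘(ℝ, E).prod 𝓘(ℝ, E →L[ℝ] ℝ)) f y₀ A) :
    ∃ B' : X →L[ℝ] X →L[ℝ] ℝ,
      HasFDerivAt (fun y => (f y).2.comp (leftDeriv (E := E) 𝓘(ℝ, X) (fun y' => (f y').1) y))
        B' y₀ ∧
      ∀ v w : X, B' w v - B' v w
        = canonicalTwoForm m (A v : E × (E →L[ℝ] ℝ)) (A w : E × (E →L[ℝ] ℝ)) := by
  obtain ⟨B', h1, h2⟩ := exists_hasFDerivAt_pullback hf hm hA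
    (differentiableAt_canonicalOneForm m) (fun y A' h => canonicalOneForm_comp h)
  refine ⟨B', h1, fun v w => ?_⟩
  have e := h2 v w
  unfold canonicalTwoForm
  rw [← e, neg_sub]

/-! ### Smoothness of the Legendre transform -/

theorem contMDiff_projHp {ℓ : G × E → ℝ}
    (hℓ : ContMDiff (𝓘(ℝ, E).prod 𝓘(ℝ, E)) 𝓘(ℝ, ℝ) ∞ ℓ) :
    ContMDiff (𝓘(ℝ, E).prod 𝓘(ℝ, E)) (𝓘(ℝ, E).prod 𝓘(ℝ, E →L[ℝ] ℝ)) ∞ (projHp ℓ) := by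
  intro x
  refine contMDiffAt_fst.prodMk ?_
  set χ := extChartAt 𝓘(ℝ, E) x.1
  have hx : χ x.1 ∈ χ.target := mem_extChartAt_target x.1
  -- The parameter `p` carries both the group coordinate and, in `p.2`, the point at which the fibre
  -- derivative is evaluated, so joint smoothness follows from smoothness of a parametrized
  -- derivative.
  set L : E × E → E → ℝ := fun p ζ => ℓ (χ.symm p.1, ζ)
  have hL : ContDiffAt ℝ ∞ (Function.uncurry L) ((χ x.1, x.2), x.2) := by
    rw [← contMDiffAt_iff_contDiffAt]
    have h1 : ContMDiffAt 𝓘(ℝ, (E × E) × E) 𝓘(ℝ, E) ∞ (fun q : (E × E) × E => χ.symm q.1.1)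
        ((χ x.1, x.2), x.2) :=
      ContMDiffAt.comp (I' := 𝓘(ℝ, E)) ((χ x.1, x.2), x.2)
        (contMDiffAt_extChartAt_symm_of_mem x.1 hx)
        (contDiff_fst.fst.contMDiff.contMDiffAt)
    exact ContMDiffAt.comp ((χ x.1, x.2), x.2) hℓ.contMDiffAt
      (h1.prodMk contDiff_snd.contMDiff.contMDiffAt)
  have h2 : ContDiffAt ℝ ∞ (fun p : E × E => fderiv ℝ (L p) p.2) (χ x.1, x.2) :=
    ContDiffAt.fderiv hL contDiffAt_snd (by simp)
  have h3 : ContMDiffAt (𝓘(ℝ, E).prod 𝓘(ℝ, E)) 𝓘(ℝ, E × E) ∞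
      (fun y : G × E => (χ y.1, y.2)) x :=
    ContMDiffAt.prodMk_space
      (ContMDiffAt.comp x (contMDiffAt_extChartAt (n := ∞)) contMDiffAt_fst) contMDiffAt_snd
  refine (ContMDiffAt.comp x h2.contMDiffAt h3).congr_of_eventuallyEq ?_
  have h4 : ∀ᶠ y : G × E in 𝓝 x, y.1 ∈ χ.source :=
    continuousAt_fst.eventually_mem (extChartAt_source_mem_nhds (I := 𝓘(ℝ, E)) x.1)
  filter_upwards [h4] with y hy
  simp only [dXi, L, Function.comp_apply, χ.left_inv hy]

end

section

variable {E : Type*} [NormedAddCommGroup E] [NormedSpace ℝ E]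
  {G : Type*} [TopologicalSpace G] [ChartedSpace E G] [Group G] [LieGroup 𝓘(ℝ, E) ∞ G]
  {X : Type*} [NormedAddCommGroup X] [NormedSpace ℝ X]
  {τ : OpenPartialHomeomorph E G} {ℓ : G × E → ℝ} {h : ℝ} {s : ℕ} {a : Fin s → Fin s → ℝ}
  {b : Fin s → ℝ}

/-! ### Symplecticity of the discrete flow -/

/-- The differential of the action of one step along a family of solutions of the scheme is the
difference of the boundary terms. -/
theorem hasFDerivAt_stepAction (hτ : IsCanonicalChart τ)
    (hℓ : ContMDiff (𝓘(ℝ, E).prod 𝓘(ℝ, E)) 𝓘(ℝ, ℝ) ∞ ℓ) (hb : ∀ i, b i ≠ 0) (hh : h ≠ 0)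
    {g₀ g₁ : X → G} {Ξ : Fin s → X → E} {x : X} {A₀ A₁ : X →L[ℝ] E} {Ξ' : Fin s → X →L[ℝ] E}
    (hg₀ : HasLeftDerivAt 𝓘(ℝ, X) g₀ x A₀) (hg₁ : HasLeftDerivAt 𝓘(ℝ, X) g₁ x A₁)
    (hΞ : ∀ i, HasFDerivAt (Ξ i) (Ξ' i) x) {c : DiscreteCurve E G 1 s} {ξ : Fin 2 → E}
    {M : Fin 1 → Fin s → E →L[ℝ] ℝ} (hc : c.InChart τ h) (hcv : c.IsVPRK τ a b h ℓ ξ M)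
    (hc₀ : c.g 0 = g₀ x) (hc₁ : c.g 1 = g₁ x) (hcΞ : ∀ i, c.Xi 0 i = Ξ i x)
    (hinc : ∀ᶠ y in 𝓝 x, τ.symm ((g₀ y)⁻¹ * g₁ y) = h • ∑ j, b j • Ξ j y) :
    HasFDerivAt (fun y => ∑ i, h * b i * ℓ (g₀ y * τ (h • ∑ j, a i j • Ξ j y), Ξ i y))
      ((c.momentum τ h ξ 1).comp A₁ - (c.momentum τ h ξ 0).comp A₀) x := by
  have hΘ : ∀ i, c.Theta 0 i = ∑ j, a i j • Ξ j x := fun i => by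
    simp only [← hcΞ]
    exact (hcv.internal 0 i).2.symm
  have hζ : h • ξ 1 = τ.symm ((g₀ x)⁻¹ * g₁ x) := by
    have h1 := (hcv.external 0).1.trans (hcv.external 0).2
    rw [inv_smul_eq_iff₀ hh] at h1
    rw [← hc₀, ← hc₁]
    exact h1.symm
  have htgt : (g₀ x)⁻¹ * g₁ x ∈ τ.target := by
    rw [← hc₀, ← hc₁]
    exact (hc 0).1
  have hζs : h • ξ 1 ∈ τ.source := hζ ▸ τ.map_target htgt
  have hsum : ∀ w : Fin s → ℝ, HasFDerivAt (fun y => ∑ j, w j • Ξ j y) (∑ j, w j • Ξ' j) x :=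
    fun w => HasFDerivAt.fun_sum fun j _ => (hΞ j).const_smul (w j)
  have hstage : ∀ i, HasFDerivAt (fun y => ℓ (g₀ y * τ (h • ∑ j, a i j • Ξ j y), Ξ i y))
      ((dual (dtauInv τ (h • c.Theta 0 i)) (c.force τ h ℓ 0 i)).comp A₀
        + h • (c.force τ h ℓ 0 i).comp (∑ j, a i j • Ξ' j) + (M 0 i).comp (Ξ' i)) x := by
    intro i
    have h1 : h • ∑ j, a i j • Ξ j x ∈ τ.source := by
      rw [← hΘ]
      exact (hc 0).2 i
    have h2 : c.stageG τ h 0 i = g₀ x * τ (h • ∑ j, a i j • Ξ j x) := by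
      rw [← hΘ, ← hc₀]; rfl
    have h3 : c.force τ h ℓ 0 i = dual (dtau τ (-(h • ∑ j, a i j • Ξ j x)))
        (gdG ℓ (g₀ x * τ (h • ∑ j, a i j • Ξ j x)) (Ξ i x)) := by
      rw [← hΘ, ← hc₀, ← hcΞ]; rfl
    have h4 := hasFDerivAt_stageLagrangian hτ hℓ hg₀ (hsum (a i)) (hΞ i) h1 h3
    rwa [← h2, ← hcΞ, ← hΘ, show dXi ℓ (c.stageG τ h 0 i) (c.Xi 0 i) = M 0 i from
      (hcv.legendre 0 i).symm] at h4
  -- The external equation holds on a neighbourhood, so both its sides may be differentiated. This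
  -- expresses the variation of the stages through those of the two endpoints.
  have hinc' := (hasFDerivAt_chart_inv_mul hτ hg₀ hg₁ htgt).unique
    (((hsum b).const_smul h).congr_of_eventuallyEq hinc)
  rw [← hζ] at hinc'
  have hM := fun i => (stageMomentum_iff (dtauInv_comp_dtau hτ hζs) (hcv.externalMomentum 0) i
    (hb i) (M 0 i)).1 (hcv.stageMomentum 0 i)
  refine (HasFDerivAt.fun_sum (u := Finset.univ) fun (i : Fin s) _ =>
    (hstage i).const_mul (h * b i)).congr_fderiv ?_
  ext v
  have hw : h • ∑ j, b j • Ξ' j v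
      = dtauInv τ (-(h • ξ 1)) (A₁ v) - dtauInv τ (h • ξ 1) (A₀ v) := by
    have := congrArg (fun φ : X →L[ℝ] E => φ v) hinc'
    simpa using this.symm
  have key := sum_stage_variation (η := A₀ v) (hcv.externalMomentum 0) hM
    (δΘ := fun i => ∑ j, a i j • Ξ' j v) (fun i => rfl) hw
  have e : c.momentum τ h ξ 1 (A₁ v) = c.mu 1 (dtauInv τ (-(h • ξ 1)) (A₁ v)) := rfl
  have e' : dual (dtauInv τ (h • ξ 1)) (c.mu 1) (A₀ v)
    = c.mu 1 (dtauInv τ (h • ξ 1) (A₀ v)) := rfl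
  have key' : ∑ i, h * b i * (dual (dtauInv τ (h • c.Theta 0 i)) (c.force τ h ℓ 0 i) (A₀ v)
      + h * c.force τ h ℓ 0 i (∑ j, a i j • Ξ' j v) + M 0 i (Ξ' i v))
    = c.mu 1 (dtauInv τ (-(h • ξ 1)) (A₁ v) - dtauInv τ (h • ξ 1) (A₀ v))
      + dual (dtauInv τ (h • ξ 1)) (c.mu 1) (A₀ v) - c.momentum τ h ξ 0 (A₀ v) := key
  -- The contribution of `μ_1` at the left end cancels, leaving `p₁` on `A₁ v` and `p₀` on `A₀ v`.
  rw [e', map_sub, sub_add_cancel] at key'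
  simp only [sub_apply, ContinuousLinearMap.comp_apply, e, ← key']
  simp [mul_add]

/-- In coordinates on `I_hp` the difference of the pulled-back one-forms at the two ends of the step
is the differential of the action. Hence its derivative is symmetric, and the antisymmetrized
derivatives of the two one-forms agree. -/
theorem IsDiscreteFlow.preservesOmegaHp (hτ : IsCanonicalChart τ)
    (hℓ : ContMDiff (𝓘(ℝ, E).prod 𝓘(ℝ, E)) 𝓘(ℝ, ℝ) ∞ ℓ) (hb : ∀ i, b i ≠ 0) (hh : h ≠ 0)
    {U : Set (admissibleSpace ℓ)} (hU : IsOpen U) {Φ : admissibleSpace ℓ → admissibleSpace ℓ}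
    (hΦ : IsDiscreteFlow τ a b h ℓ U Φ) : PreservesOmegaHp ℓ U Φ := by
  obtain ⟨c, ξ, M, hΞ, hsol⟩ := hΦ.scheme
  set V : Set (G × E) := (graphChart ℓ).symm ⁻¹' U
  -- `U` is open in the subspace topology, and the inverse graph chart is continuous because `∂ℓ/∂ξ`
  -- is.
  have hVo : IsOpen V := by
    refine hU.preimage (Continuous.subtype_mk ?_ _)
    exact continuous_fst.prodMk (continuous_snd.prodMk (contMDiff_projHp hℓ).continuous.snd)
  set J := 𝓘(ℝ, E).prod 𝓘(ℝ, E)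
  set P := inGraphChart ℓ Φ
  intro x hx v w
  set φ := extChartAt J x
  have hφx : φ.symm (φ x) = x := φ.left_inv (mem_extChartAt_source x)
  have hφt : φ.target ∈ 𝓝 (φ x) :=
    (isOpen_extChartAt_target x).mem_nhds (mem_extChartAt_target x)
  have hκ : ∀ y ∈ φ.target, ContMDiffAt 𝓘(ℝ, E × E) J ∞ φ.symm y := fun y hy =>
    contMDiffAt_extChartAt_symm_of_mem x hy
  have hκ0 := hκ _ (mem_extChartAt_target x)
  -- With identity derivative at the base point, `v` and `w` serve unchanged as coordinate vectors.
  have hκid : HasModelDerivAt 𝓘(ℝ, E × E) J φ.symm (φ x) (ContinuousLinearMap.id ℝ (E × E)) := by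
    obtain ⟨A, h1⟩ : ∃ A : E × E →L[ℝ] E × E, HasModelDerivAt 𝓘(ℝ, E × E) J φ.symm (φ x) A :=
      ⟨_, (hκ0.mdifferentiableAt (by simp)).hasModelDerivAt⟩
    have h2 := HasModelDerivAt.comp (hasModelDerivAt_extChartAt_self (I := J) x) h1 hφx
    have h3 := h2.unique ((hasModelDerivAt_id (φ x)).congr (by
      filter_upwards [hφt] with y hy
      exact φ.right_inv hy))
    rw [ContinuousLinearMap.id_comp] at h3
    rw [h3] at h1
    exact h1
  have hW : ∀ᶠ y in 𝓝 (φ x), y ∈ φ.target ∧ φ.symm y ∈ V :=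
    Filter.Eventually.and hφt (hκ0.continuousAt.eventually_mem
      (hVo.mem_nhds (by rw [hφx]; exact hx)))
  have hP : ∀ z ∈ V, ContMDiffAt J J ∞ P z := fun z hz =>
    hΦ.smooth.contMDiffAt (hVo.mem_nhds hz)
  have hPκ : ∀ y, y ∈ φ.target ∧ φ.symm y ∈ V →
      ContMDiffAt 𝓘(ℝ, E × E) J ∞ (fun y => P (φ.symm y)) y := fun y hy =>
    ContMDiffAt.comp (g := P) y (hP _ hy.2) (hκ y hy.1)
  have hpr : ∀ z : G × E, HasModelDerivAt J (𝓘(ℝ, E).prod 𝓘(ℝ, E →L[ℝ] ℝ)) (projHp ℓ) z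
      (mfderiv J (𝓘(ℝ, E).prod 𝓘(ℝ, E →L[ℝ] ℝ)) (projHp ℓ) z) := fun z =>
    ((contMDiff_projHp hℓ z).mdifferentiableAt (by simp)).hasModelDerivAt
  have hPd : HasModelDerivAt J J P x (mfderiv J J P x) :=
    ((hP x hx).mdifferentiableAt (by simp)).hasModelDerivAt
  obtain ⟨B₀, hB₀, hω₀⟩ := exists_hasFDerivAt_canonicalTwoForm
    (f := fun y => projHp ℓ (φ.symm y)) (y₀ := φ x) (m := projHp ℓ x)
    ((ContMDiffAt.comp (φ x) (contMDiff_projHp hℓ).contMDiffAt hκ0).of_le two_le_infty)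
    (by rw [hφx]) ((hpr x).comp hκid hφx)
  obtain ⟨B₁, hB₁, hω₁⟩ := exists_hasFDerivAt_canonicalTwoForm
    (f := fun y => projHp ℓ (P (φ.symm y))) (y₀ := φ x) (m := projHp ℓ (P x))
    ((ContMDiffAt.comp (φ x) (contMDiff_projHp hℓ).contMDiffAt
      (hPκ _ hW.self_of_nhds)).of_le two_le_infty)
    (by rw [hφx]) ((hpr (P x)).comp (hPd.comp hκid hφx) (by rw [hφx]))
  set Ξ : Fin s → E × E → E := fun i y => (c ((graphChart ℓ).symm (φ.symm y))).Xi 0 i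
  have hact : ∀ᶠ y in 𝓝 (φ x), HasFDerivAt
      (fun y => ∑ i, h * b i * ℓ ((φ.symm y).1 * τ (h • ∑ j, a i j • Ξ j y), Ξ i y))
      ((projHp ℓ (P (φ.symm y))).2.comp
          (leftDeriv (E := E) 𝓘(ℝ, E × E) (fun y => (P (φ.symm y)).1) y)
        - (projHp ℓ (φ.symm y)).2.comp
          -- The differential is identified on a whole neighbourhood, as needed to differentiate
          -- again. Only the stages need to be smooth in the family of solutions: both endpoints are
          -- smooth through `φ.symm` and `P`, and the remaining data enter pointwise.
          (leftDeriv (E := E) 𝓘(ℝ, E × E) (fun y => (φ.symm y).1) y)) y := by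
    filter_upwards [hW.eventually_nhds] with y hWy
    have hy := hWy.self_of_nhds
    have h0 : HasLeftDerivAt 𝓘(ℝ, E × E) (fun y => (φ.symm y).1) y _ :=
      ((hκ y hy.1).fst.mdifferentiableAt (by simp)).hasLeftDerivAt
    have h1 : HasLeftDerivAt 𝓘(ℝ, E × E) (fun y => (P (φ.symm y)).1) y _ :=
      ((hPκ y hy).fst.mdifferentiableAt (by simp)).hasLeftDerivAt
    have hΞd : ∀ i, HasFDerivAt (Ξ i) (fderiv ℝ (Ξ i) y) y := fun i => by
      have := ContMDiffAt.comp y ((hΞ i).contMDiffAt (hVo.mem_nhds hy.2)) (hκ y hy.1)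
      exact (this.contDiffAt.differentiableAt (by simp)).hasFDerivAt
    obtain ⟨q1, q2, q3, q4, q5, q6, q7⟩ := hsol _ hy.2
    have hres := hasFDerivAt_stepAction hτ hℓ hb hh h0 h1 hΞd q1 q3 q4 q6 (fun i => rfl) ?_
    · rw [q5, q7] at hres
      -- The image point lies in `I_hp`, so its momentum coordinate is the Legendre transform of its
      -- velocity.
      have e : (projHp ℓ (P (φ.symm y))).2 = (Φ ((graphChart ℓ).symm (φ.symm y))).1.2.2 :=
        (Φ ((graphChart ℓ).symm (φ.symm y))).2.symm
      rw [e]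
      exact hres
    · filter_upwards [hWy] with y' hy'
      obtain ⟨-, -, r3, r4, -, r6, -⟩ := hsol _ hy'.2
      have h2 := (r3.external 0).1
      rw [inv_smul_eq_iff₀ hh] at h2
      change τ.symm (((c _).g 0)⁻¹ * (c _).g 1) = _ at h2
      rw [r4, r6] at h2
      exact h2
  have hsymm : B₁ v w - B₀ v w = B₁ w v - B₀ w v :=
    second_derivative_symmetric_of_eventually hact (hB₁.sub hB₀) v w
  have e1 := hω₁ v w
  have e0 := hω₀ v w
  change canonicalTwoForm (projHp ℓ (P x)) _ _ = canonicalTwoForm (projHp ℓ x) _ _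
  refine (e1.symm.trans ?_).trans e0
  linarith

end

end LieVPRK

end

theorem mainTheorem3
    {E : Type*} [NormedAddCommGroup E] [NormedSpace ℝ E] [FiniteDimensional ℝ E]
    {G : Type*} [TopologicalSpace G] [ChartedSpace E G] [Group G] [LieGroup 𝓘(ℝ, E) ∞ G]
    (τ : OpenPartialHomeomorph E G) (hτ : LieVPRK.IsCanonicalChart τ)
    (ℓ : G × E → ℝ) (hℓ : ContMDiff (𝓘(ℝ, E).prod 𝓘(ℝ, E)) 𝓘(ℝ, ℝ) ∞ ℓ)
    (s : ℕ) (a : Fin s → Fin s → ℝ) (b : Fin s → ℝ) (hb : ∀ i, b i ≠ 0)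
    (h : ℝ) (hh : 0 < h) :
    (∀ (N : ℕ), 0 < N → ∀ (g₁ g₂ : G),
      ∀ c ∈ LieVPRK.DiscreteCurve.pathSpace E N s g₁ g₂, c.InChart τ h →
      ∀ ξ₀ : E, h • ξ₀ ∈ τ.source →
        (c.IsCritical τ a b h ℓ g₁ g₂ ↔
          (∃! ν : E →L[ℝ] ℝ, (c.withMuZero ν).SatisfiesVPRK τ a b h ℓ ξ₀) ∧
            ∀ (k : Fin N) (i : Fin s),
              c.muStage k.castSucc i = -((h * b i) • c.force τ h ℓ k i))) ∧
    (∀ (U : Set (LieVPRK.admissibleSpace ℓ)) (F : LieVPRK.admissibleSpace ℓ →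
        LieVPRK.admissibleSpace ℓ), IsOpen U → LieVPRK.IsDiscreteFlow τ a b h ℓ U F →
      LieVPRK.PreservesOmegaHp ℓ U F) := by
  refine ⟨fun N hN g₁ g₂ c hc hch ξ₀ hξ₀ => ?_, fun U F hU hF =>
    hF.preservesOmegaHp hτ hℓ hb hh.ne' hU⟩
  -- With `N = n + 1` there are `n` interior nodes, indexed by `Fin n`, and a step zero to determine
  -- `μ_0`.
  obtain ⟨n, rfl⟩ := Nat.exists_eq_succ_of_ne_zero hN.ne'
  exact (LieVPRK.DiscreteCurve.isCritical_iff_coefficients hτ hℓ hh.ne' hc hch).trans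
    (LieVPRK.DiscreteCurve.satisfiesVPRK_and_muStage_iff hτ hb hh.ne' hch hξ₀).symm
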